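/- Fix $n,m\in\mathbb N$ and let $Ag=\{1,\dots,m\}$. **Language.** Formulae of $\mathcal L^m$ are in negation normal form: $\phi ::= p \mid \overline p \mid \phi\wedge\phi\mid\phi\vee\phi\mid\Box\phi\mid\Diamond\phi\mid[i]\phi\mid\langle i\rangle\phi$, where $i\in Ag$ and $p$ ranges over a countably infinite set of propositional variables. The negation $\overline\phi$ is obtained by replacing each of $\wedge,\vee,\Box,\Diamond,[i],\langle i\rangle$ by its dual and exchanging $p$ and $\overline p$; $\phi\to\psi$ abbreviates $\overline\phi\vee\psi$. An empty conjunction is $\top:=p_0\vee\overline{p_0}$, for a fixed variable $p_0$. **Hilbert system $\mathsf{Ldm}_n^m$.** Axiom schemes, for all $i \in Ag$: $\phi\to(\psi\to\phi)$; $(\overline\psi\to\overline\phi)\to(\phi\to\psi)$; $(\phi\to(\psi\to\chi))\to((\phi\to\psi)\to(\phi\to\chi))$; for $\triangle=\Box$ with dual $\triangledown=\Diamond$ and for $\triangle=[i]$ with dual $\triangledown=\langle i\rangle$: $\triangle(\phi\to\psi)\to(\triangle\phi\to\triangle\psi)$, $\triangle\phi\to\phi$, $\triangledown\phi\to\triangle\triangledown\phi$,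 $\triangle\phi\vee\triangledown\overline\phi$; $\Box\phi\to[i]\phi$; $\bigwedge_{i\in Ag}\Diamond[i]\phi_i\to\Diamond\bigwedge_{i\in Ag}[i]\phi_i$; and, only if $n>0$, $$\Diamond[i]\phi_1\wedge\Diamond(\overline{\phi}_1\wedge[i]\phi_2)\wedge\dots\wedge\Diamond(\overline\phi_1\wedge\dots\wedge\overline\phi_{n-1}\wedge[i]\phi_n)\to\phi_1\vee\dots\vee\phi_n .$$ The rules are modus ponens and $\phi/\Box\phi$. **Calculus $\mathsf{G3Ldm}_n^m$.** A sequent $\mathcal R,\Gamma$ consists of a finite multiset $\mathcal R$ of relational atoms $\mathcal R_ixy$ ($i \in Ag$) and a finite multiset $\Gamma$ of labelled formulae $x:\phi$ ($\phi \in \mathcal L^m$), where the labels are taken from a countably infinite set. The rules, for all $i\in Ag$ and written premises / conclusion, are: - $(\mathsf{id})$: no premise / $\mathcal R,w:p,w:\overline p,\Gamma$; - $(\wedge)$: $\mathcal R,w:\phi\wedge\psi,w:\phi,\Gamma$ and $\mathcal R,w:\phi\wedge\psi,w:\psi,\Gamma$ / $\mathcal R,w:\phi\wedge\psi,\Gamma$;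 - $(\vee)$: $\mathcal R,w:\phi\vee\psi,w:\phi,w:\psi,\Gamma$ / $\mathcal R,w:\phi\vee\psi,\Gamma$; - $([i])$: $\mathcal R,\mathcal R_iwv,v:\phi,\Gamma$ / $\mathcal R,w:[i]\phi,\Gamma$, with $v$ not occurring in the conclusion; - $(\Box)$: $\mathcal R,w:\Box\phi,v:\phi,\Gamma$ / $\mathcal R,w:\Box\phi,\Gamma$, with $v$ not occurring in the conclusion; - $(\Diamond)$: $\mathcal R,w:\Diamond\phi,u:\phi,\Gamma$ / $\mathcal R,w:\Diamond\phi,\Gamma$; - $(\langle i\rangle)$: $\mathcal R,\mathcal R_iwu,w:\langle i\rangle\phi,u:\phi,\Gamma$ / $\mathcal R,\mathcal R_iwu,w:\langle i\rangle\phi,\Gamma$; - $(\mathsf{refl}_i)$: $\mathcal R,\mathcal R_iww,\Gamma$ / $\mathcal R,\Gamma$; - $(\mathsf{eucl}_i)$: $\mathcal R,\mathcal R_iwu,\mathcal R_iwv,\mathcal R_iuv,\Gamma$ / $\mathcal R,\mathcal R_iwu,\mathcal R_iwv,\Gamma$; - $(\mathsf{IOA})$: $\mathcal R,\mathcal R_1u_1v,\dots,\mathcal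 R_mu_mv,\Gamma$ / $\mathcal R,\Gamma$, with $v$ not occurring in the conclusion and distinct from $u_1,\dots,u_m$; - $(\mathsf{APC}_n^i)$, only if $n>0$: the premises $\mathcal R,\mathcal R_iw_kw_j,\Gamma$ for all $0\le k<j\le n$ / $\mathcal R,\Gamma$. The height of a derivation is the maximal number of sequents on a branch. A rule is admissible if its conclusion is derivable whenever its premises are; a one-premise rule is height-preserving admissible if, for every $h$, its conclusion has a derivation of height at most $h$ whenever its premise does; a rule is height-preserving invertible if, for every instance of it and every $h$, each premise has a derivation of height at most $h$ whenever the conclusion does. **Theorem.** For all $n,m\in\mathbb N$: 1. Every sequent of the form $\mathcal R,w:\phi,w:\overline\phi,\Gamma$ is derivable in $\mathsf{G3Ldm}_n^m$. 2. Substitution of a label for a label throughout a sequent is height-preserving admissible. 3. All rules of $\mathsf{G3Ldm}_n^m$ are height-preserving invertible. 4. Weakening (from $\mathcal R,\Gamma$ infer $\mathcal R,\mathcal R',\Gamma',\Gamma$) and the contractions (from $\mathcal R,\mathcal R',\mathcal R',\Gamma$ infer $\mathcal R,\mathcal R',\Gamma$; from $\mathcal R,\Gamma',\Gamma',\Gamma$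 infer $\mathcal R,\Gamma',\Gamma$) are height-preserving admissible. 5. Cut (from $\mathcal R,x:\phi,\Gamma$ and $\mathcal R,x:\overline\phi,\Gamma$ infer $\mathcal R,\Gamma$) is admissible. 6. For every formula $\phi\in\mathcal L^m$ and every label $w$, the sequent $w:\phi$ is derivable in $\mathsf{G3Ldm}_n^m$ if and only if $\phi$ is a theorem of $\mathsf{Ldm}_n^m$. -/

import Mathlib

namespace STIT

/-- Formulae of the language `L^m` in negation normal form. The propositional variables are the
natural numbers and the agents are the elements of `Fin m`. -/
inductive Formula (m : ℕ) : Type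
  /-- a propositional variable `p` -/
  | pos (p : ℕ) : Formula m
  /-- a negated propositional variable `p̄` -/
  | neg (p : ℕ) : Formula m
  | and (φ ψ : Formula m) : Formula m
  | or (φ ψ : Formula m) : Formula m
  /-- settledness `□ φ` -/
  | box (φ : Formula m) : Formula m
  /-- `◇ φ` -/
  | dia (φ : Formula m) : Formula m
  /-- Chellas stit `[i] φ` -/
  | stit (i : Fin m) (φ : Formula m) : Formula m
  /-- its dual `⟨i⟩ φ` -/
  | cstit (i : Fin m) (φ : Formula m) : Formula m

namespace Formula

variable {m : ℕ}

/-- The negation of a formula: every operator is replaced by its dual, and every literal by the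
opposite literal. -/
def not : Formula m → Formula m
  | pos p => neg p
  | neg p => pos p
  | and φ ψ => or φ.not ψ.not
  | or φ ψ => and φ.not ψ.not
  | box φ => dia φ.not
  | dia φ => box φ.not
  | stit i φ => cstit i φ.not
  | cstit i φ => stit i φ.not

/-- `φ → ψ` abbreviates the disjunction of the negation of `φ` with `ψ`. -/
def imp (φ ψ : Formula m) : Formula m := or φ.not ψ

def top : Formula m := or (pos 0) (neg 0)

def bot : Formula m := and (pos 0) (neg 0)

/-- Conjunction of a finite list of formulae (`⊤` for the empty list). -/
def conj : List (Formula m) → Formula m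
  | [] => top
  | [φ] => φ
  | φ :: ψ :: l => and φ (conj (ψ :: l))

/-- Disjunction of a finite list of formulae (`⊥` for the empty list). -/
def disj : List (Formula m) → Formula m
  | [] => bot
  | [φ] => φ
  | φ :: ψ :: l => or φ (disj (ψ :: l))

end Formula

open Formula in
/-- Theorems of the Hilbert system `Ldm_n^m`. -/
inductive HilbertTheorem (n m : ℕ) : Formula m → Prop
  | prop1 (φ ψ : Formula m) : HilbertTheorem n m (imp φ (imp ψ φ))
  | prop2 (φ ψ : Formula m) : HilbertTheorem n m (imp (imp ψ.not φ.not) (imp φ ψ))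
  | prop3 (φ ψ χ : Formula m) :
      HilbertTheorem n m (imp (imp φ (imp ψ χ)) (imp (imp φ ψ) (imp φ χ)))
  | boxK (φ ψ : Formula m) : HilbertTheorem n m (imp (box (imp φ ψ)) (imp (box φ) (box ψ)))
  | boxT (φ : Formula m) : HilbertTheorem n m (imp (box φ) φ)
  | box5 (φ : Formula m) : HilbertTheorem n m (imp (dia φ) (box (dia φ)))
  | boxDual (φ : Formula m) : HilbertTheorem n m (or (box φ) (dia φ.not))
  | stitK (i : Fin m) (φ ψ : Formula m) :
      HilbertTheorem n m (imp (stit i (imp φ ψ)) (imp (stit i φ) (stit i ψ)))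
  | stitT (i : Fin m) (φ : Formula m) : HilbertTheorem n m (imp (stit i φ) φ)
  | stit5 (i : Fin m) (φ : Formula m) :
      HilbertTheorem n m (imp (cstit i φ) (stit i (cstit i φ)))
  | stitDual (i : Fin m) (φ : Formula m) : HilbertTheorem n m (or (stit i φ) (cstit i φ.not))
  | ioa (φ : Fin m → Formula m) :
      HilbertTheorem n m
        (imp (conj (List.ofFn fun i => dia (stit i (φ i))))
          (dia (conj (List.ofFn fun i => stit i (φ i)))))
  | bridge (i : Fin m) (φ : Formula m) : HilbertTheorem n m (imp (box φ) (stit i φ))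
  /-- The `n`-choice schema, present only for `n > 0`; the formulae `φ_1, …, φ_n` are here
  `φ 0, …, φ (n - 1)`. -/
  | apc (hn : 0 < n) (i : Fin m) (φ : ℕ → Formula m) :
      HilbertTheorem n m
        (imp
          (conj ((List.range n).map fun k =>
            dia (conj ((List.range k).map (fun j => (φ j).not) ++ [stit i (φ k)]))))
          (disj ((List.range n).map φ)))
  | nec {φ : Formula m} : HilbertTheorem n m φ → HilbertTheorem n m (box φ)
  | mp {φ ψ : Formula m} :
      HilbertTheorem n m φ → HilbertTheorem n m (imp φ ψ) → HilbertTheorem n m ψ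

/-- The relational atom `R_i x y`; labels are natural numbers. -/
structure RelAtom (m : ℕ) : Type where
  agent : Fin m
  src : ℕ
  tgt : ℕ

/-- The labelled formula `x : φ`. -/
structure LabFormula (m : ℕ) : Type where
  label : ℕ
  formula : Formula m

/-- The labelled sequent `R, Γ`: a finite multiset of relational atoms and a finite multiset of
labelled formulae. -/
structure Sequent (m : ℕ) : Type where
  rel : Multiset (RelAtom m)
  fml : Multiset (LabFormula m)

namespace Sequent

variable {m : ℕ}

/-- The label `v` does not occur in the sequent. -/
def Fresh (v : ℕ) (s : Sequent m) : Prop :=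
  (∀ a ∈ s.rel, a.src ≠ v ∧ a.tgt ≠ v) ∧ ∀ f ∈ s.fml, f.label ≠ v

/-- Apply a map of labels to every label of a sequent. -/
def mapLabels (σ : ℕ → ℕ) (s : Sequent m) : Sequent m :=
  ⟨s.rel.map fun a => ⟨a.agent, σ a.src, σ a.tgt⟩, s.fml.map fun f => ⟨σ f.label, f.formula⟩⟩

/-- The substitution of the label `y` for the label `x` in a sequent. -/
def subst (y x : ℕ) (s : Sequent m) : Sequent m :=
  s.mapLabels fun z => if z = x then y else z

end Sequent

open Formula in
/-- `Rule n m prems c`: there is an instance of an inference rule of `G3Ldm_n^m` with set of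
premises `prems` and conclusion `c`. -/
inductive Rule (n m : ℕ) : Set (Sequent m) → Sequent m → Prop
  | id (R : Multiset (RelAtom m)) (Γ : Multiset (LabFormula m)) (w p : ℕ) :
      Rule n m ∅ ⟨R, ⟨w, pos p⟩ ::ₘ ⟨w, neg p⟩ ::ₘ Γ⟩
  | and (R : Multiset (RelAtom m)) (Γ : Multiset (LabFormula m)) (w : ℕ) (φ ψ : Formula m) :
      Rule n m {⟨R, ⟨w, and φ ψ⟩ ::ₘ ⟨w, φ⟩ ::ₘ Γ⟩, ⟨R, ⟨w, and φ ψ⟩ ::ₘ ⟨w, ψ⟩ ::ₘ Γ⟩}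
        ⟨R, ⟨w, and φ ψ⟩ ::ₘ Γ⟩
  | or (R : Multiset (RelAtom m)) (Γ : Multiset (LabFormula m)) (w : ℕ) (φ ψ : Formula m) :
      Rule n m {⟨R, ⟨w, or φ ψ⟩ ::ₘ ⟨w, φ⟩ ::ₘ ⟨w, ψ⟩ ::ₘ Γ⟩} ⟨R, ⟨w, or φ ψ⟩ ::ₘ Γ⟩
  | stit (R : Multiset (RelAtom m)) (Γ : Multiset (LabFormula m)) (i : Fin m) (w v : ℕ)
      (φ : Formula m) (hv : Sequent.Fresh v ⟨R, ⟨w, stit i φ⟩ ::ₘ Γ⟩) :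
      Rule n m {⟨⟨i, w, v⟩ ::ₘ R, ⟨v, φ⟩ ::ₘ Γ⟩} ⟨R, ⟨w, stit i φ⟩ ::ₘ Γ⟩
  | box (R : Multiset (RelAtom m)) (Γ : Multiset (LabFormula m)) (w v : ℕ)
      (φ : Formula m) (hv : Sequent.Fresh v ⟨R, ⟨w, box φ⟩ ::ₘ Γ⟩) :
      Rule n m {⟨R, ⟨w, box φ⟩ ::ₘ ⟨v, φ⟩ ::ₘ Γ⟩} ⟨R, ⟨w, box φ⟩ ::ₘ Γ⟩
  | dia (R : Multiset (RelAtom m)) (Γ : Multiset (LabFormula m)) (w u : ℕ) (φ : Formula m) :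
      Rule n m {⟨R, ⟨w, dia φ⟩ ::ₘ ⟨u, φ⟩ ::ₘ Γ⟩} ⟨R, ⟨w, dia φ⟩ ::ₘ Γ⟩
  | cstit (R : Multiset (RelAtom m)) (Γ : Multiset (LabFormula m)) (i : Fin m) (w u : ℕ)
      (φ : Formula m) :
      Rule n m {⟨⟨i, w, u⟩ ::ₘ R, ⟨w, cstit i φ⟩ ::ₘ ⟨u, φ⟩ ::ₘ Γ⟩}
        ⟨⟨i, w, u⟩ ::ₘ R, ⟨w, cstit i φ⟩ ::ₘ Γ⟩
  | refl (R : Multiset (RelAtom m)) (Γ : Multiset (LabFormula m)) (i : Fin m) (w : ℕ) :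
      Rule n m {⟨⟨i, w, w⟩ ::ₘ R, Γ⟩} ⟨R, Γ⟩
  | eucl (R : Multiset (RelAtom m)) (Γ : Multiset (LabFormula m)) (i : Fin m) (w u v : ℕ) :
      Rule n m {⟨⟨i, w, u⟩ ::ₘ ⟨i, w, v⟩ ::ₘ ⟨i, u, v⟩ ::ₘ R, Γ⟩}
        ⟨⟨i, w, u⟩ ::ₘ ⟨i, w, v⟩ ::ₘ R, Γ⟩
  /-- The premise adds the atoms `R_i (u i) v`, one for each agent `i`, where `v` is an
  eigenvariable. -/
  | ioa (R : Multiset (RelAtom m)) (Γ : Multiset (LabFormula m)) (u : Fin m → ℕ) (v : ℕ)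
      (hv : Sequent.Fresh v ⟨R, Γ⟩) (hu : ∀ i, u i ≠ v) :
      Rule n m {⟨(Finset.univ : Finset (Fin m)).val.map (fun i => ⟨i, u i, v⟩) + R, Γ⟩} ⟨R, Γ⟩
  /-- One premise for each pair `0 ≤ k < j ≤ n`, adding the atom `R_i (w k) (w j)`; the rule is
  absent for `n = 0`. -/
  | apc (hn : 0 < n) (R : Multiset (RelAtom m)) (Γ : Multiset (LabFormula m)) (i : Fin m)
      (w : ℕ → ℕ) :
      Rule n m {s | ∃ k j : ℕ, k < j ∧ j ≤ n ∧ s = ⟨⟨i, w k, w j⟩ ::ₘ R, Γ⟩} ⟨R, Γ⟩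

/-- `DerivableIn n m h s`: the sequent `s` has a derivation in `G3Ldm_n^m` of height at most `h`,
the height being the maximal number of sequents on a branch. -/
inductive DerivableIn (n m : ℕ) : ℕ → Sequent m → Prop
  | step {h : ℕ} {prems : Set (Sequent m)} {c : Sequent m} (r : Rule n m prems c)
      (d : ∀ p ∈ prems, DerivableIn n m h p) : DerivableIn n m (h + 1) c

theorem DerivableIn.mono {n m : ℕ} {h h' : ℕ} {s : Sequent m} (d : DerivableIn n m h s)
    (hh : h ≤ h') : DerivableIn n m h' s := by
  induction d generalizing h' with
  | step r _ ih =>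
    obtain ⟨k, rfl⟩ : ∃ k, h' = k + 1 := ⟨h' - 1, by omega⟩
    exact .step r fun p hp => ih p hp (by omega)

/-- The sequent `s` is derivable in `G3Ldm_n^m`. -/
def Derivable (n m : ℕ) (s : Sequent m) : Prop := ∃ h, DerivableIn n m h s

end STIT

namespace STIT

variable {n m : ℕ}

/-! The structural claims are proved in an equivalent calculus, `Step`/`Deriv`, whose premises only
add material to the conclusion and whose principal items need only be members of it. There a
derivation of `s` becomes one of any sequent that includes a relabelled `s`, multiplicities ignored,
at the same height: substitution, weakening and contraction are one induction (`Deriv.map`), with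
eigenvariables renamed on the way. The two calculi agree height by height. The main discrepancy is
the rule for `[i]`, whose original premise drops the principal formula; `Deriv.stit_elim` bridges it
by sending the eigenvariable to a label that is already an instance. Invertibility follows: every
other premise is a weakening of its conclusion.

Cut is eliminated by induction on the cut formula. `Derivable.remove` walks through one derivation
and repairs each place where the cut formula is principal, by inverting the other premise and
cutting on a subformula.

For the comparison with the Hilbert system, theorems are derivable because each axiom is, while the
`□` rule gives necessitation and cut gives modus ponens. Conversely, a derivable formula holds in
every model with universal `□`, and the canonical model, restricted to one `□`-class of maximal
consistent sets, shows that valid formulae are theorems. The independence and choice axioms are what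
give that class its frame conditions. -/

@[simp]
theorem Formula.not_not (φ : Formula m) : φ.not.not = φ := by
  induction φ <;> simp_all [Formula.not]

/-! ### Inclusion, relabelling and fresh labels -/

namespace Sequent

/-- The union of two sequents. -/
def append (e s : Sequent m) : Sequent m := ⟨e.rel + s.rel, e.fml + s.fml⟩

/-- Inclusion of sequents, disregarding multiplicities. -/
def Incl (s t : Sequent m) : Prop := s.rel ⊆ t.rel ∧ s.fml ⊆ t.fml

theorem Incl.refl (s : Sequent m) : Incl s s := ⟨fun _ h => h, fun _ h => h⟩

theorem Incl.append {s t : Sequent m} (h : Incl s t) (e : Sequent m) :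
    Incl (e.append s) (e.append t) := by
  constructor
  · intro a ha
    rcases Multiset.mem_add.1 ha with ha | ha
    · exact Multiset.mem_add.2 (.inl ha)
    · exact Multiset.mem_add.2 (.inr (h.1 ha))
  · intro a ha
    rcases Multiset.mem_add.1 ha with ha | ha
    · exact Multiset.mem_add.2 (.inl ha)
    · exact Multiset.mem_add.2 (.inr (h.2 ha))

theorem mapLabels_append (σ : ℕ → ℕ) (e s : Sequent m) :
    (e.append s).mapLabels σ = (e.mapLabels σ).append (s.mapLabels σ) := by
  simp [append, mapLabels]

theorem mapLabels_id (s : Sequent m) : s.mapLabels id = s := by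
  simp [mapLabels]

theorem mapLabels_congr {σ τ : ℕ → ℕ} {s : Sequent m}
    (h : ∀ v, ¬ Fresh v s → σ v = τ v) : s.mapLabels σ = s.mapLabels τ := by
  unfold mapLabels
  congr 1
  · refine Multiset.map_congr rfl fun a ha => ?_
    rw [h a.src fun hf => (hf.1 a ha).1 rfl, h a.tgt fun hf => (hf.1 a ha).2 rfl]
  · refine Multiset.map_congr rfl fun a ha => ?_
    rw [h a.label fun hf => hf.2 a ha rfl]

/-- Lets an eigenvariable be redirected at will without disturbing the conclusion of its rule. -/
theorem mapLabels_update {σ : ℕ → ℕ} {s : Sequent m} {v : ℕ} (hv : Fresh v s) (v' : ℕ) :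
    s.mapLabels (Function.update σ v v') = s.mapLabels σ := by
  refine mapLabels_congr fun z hz => Function.update_of_ne ?_ _ _
  rintro rfl
  exact hz hv

theorem Fresh.mono {s t : Sequent m} {v : ℕ} (h : Fresh v t) (hs : Incl s t) : Fresh v s :=
  ⟨fun a ha => h.1 a (hs.1 ha), fun a ha => h.2 a (hs.2 ha)⟩

theorem exists_fresh (s : Sequent m) (F : Finset ℕ) : ∃ v, v ∉ F ∧ Fresh v s := by
  obtain ⟨v, hv⟩ := Infinite.exists_notMem_finset
    (F ∪ (s.rel.map RelAtom.src + s.rel.map RelAtom.tgt + s.fml.map LabFormula.label).toFinset)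
  simp only [Finset.mem_union, Multiset.mem_toFinset, Multiset.mem_add, Multiset.mem_map,
    not_or, not_exists, not_and] at hv
  exact ⟨v, hv.1, fun a ha => ⟨hv.2.1.1 a ha, hv.2.1.2 a ha⟩, hv.2.2⟩

end Sequent

/-! ### The cumulative calculus and its structural rules -/

open Sequent Formula

/-- `Step n m s E`: some rule instance with cumulative premises `e.append s`, for `e ∈ E`, has the
conclusion `s`; principal formulae and atoms are only required to be members of `s`. -/
inductive Step (n m : ℕ) : Sequent m → Set (Sequent m) → Prop
  | id {s : Sequent m} {w p : ℕ} (h : ⟨w, pos p⟩ ∈ s.fml) (h' : ⟨w, neg p⟩ ∈ s.fml) : Step n m s ∅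
  | and {s : Sequent m} {w : ℕ} {φ ψ : Formula m} (h : ⟨w, and φ ψ⟩ ∈ s.fml) :
      Step n m s {⟨0, {⟨w, φ⟩}⟩, ⟨0, {⟨w, ψ⟩}⟩}
  | or {s : Sequent m} {w : ℕ} {φ ψ : Formula m} (h : ⟨w, or φ ψ⟩ ∈ s.fml) :
      Step n m s {⟨0, {⟨w, φ⟩, ⟨w, ψ⟩}⟩}
  | stit {s : Sequent m} {i : Fin m} {w v : ℕ} {φ : Formula m} (h : ⟨w, stit i φ⟩ ∈ s.fml)
      (hv : Fresh v s) : Step n m s {⟨{⟨i, w, v⟩}, {⟨v, φ⟩}⟩}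
  | box {s : Sequent m} {w v : ℕ} {φ : Formula m} (h : ⟨w, box φ⟩ ∈ s.fml) (hv : Fresh v s) :
      Step n m s {⟨0, {⟨v, φ⟩}⟩}
  | dia {s : Sequent m} {w u : ℕ} {φ : Formula m} (h : ⟨w, dia φ⟩ ∈ s.fml) :
      Step n m s {⟨0, {⟨u, φ⟩}⟩}
  | cstit {s : Sequent m} {i : Fin m} {w u : ℕ} {φ : Formula m} (h : ⟨w, cstit i φ⟩ ∈ s.fml)
      (h' : ⟨i, w, u⟩ ∈ s.rel) : Step n m s {⟨0, {⟨u, φ⟩}⟩}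
  | refl {s : Sequent m} (i : Fin m) (w : ℕ) : Step n m s {⟨{⟨i, w, w⟩}, 0⟩}
  | eucl {s : Sequent m} {i : Fin m} {w u v : ℕ} (h : ⟨i, w, u⟩ ∈ s.rel) (h' : ⟨i, w, v⟩ ∈ s.rel) :
      Step n m s {⟨{⟨i, u, v⟩}, 0⟩}
  | ioa {s : Sequent m} (u : Fin m → ℕ) (v : ℕ) (hv : Fresh v s) (hu : ∀ i, u i ≠ v) :
      Step n m s {⟨(Finset.univ : Finset (Fin m)).val.map (fun i => ⟨i, u i, v⟩), 0⟩}
  | apc {s : Sequent m} (hn : 0 < n) (i : Fin m) (w : ℕ → ℕ) :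
      Step n m s {e | ∃ k j : ℕ, k < j ∧ j ≤ n ∧ e = ⟨{⟨i, w k, w j⟩}, 0⟩}

/-- Height-bounded derivability in the calculus with the cumulative rules `Step`. -/
inductive Deriv (n m : ℕ) : ℕ → Sequent m → Prop
  | step {h : ℕ} {s : Sequent m} {E : Set (Sequent m)} (r : Step n m s E)
      (d : ∀ e ∈ E, Deriv n m h (e.append s)) : Deriv n m (h + 1) s

/-- A rule instance can be relabelled and its conclusion enlarged. -/
theorem Step.map {s : Sequent m} {E : Set (Sequent m)} (r : Step n m s E) (σ : ℕ → ℕ)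
    {t : Sequent m} (hs : Incl (s.mapLabels σ) t) :
    ∃ σ' E', Step n m t E' ∧ s.mapLabels σ' = s.mapLabels σ ∧
      ∀ e' ∈ E', ∃ e ∈ E, e' = e.mapLabels σ' := by
  have hR : ∀ {i x y}, (⟨i, x, y⟩ : RelAtom m) ∈ s.rel → ⟨i, σ x, σ y⟩ ∈ t.rel :=
    fun h => hs.1 (Multiset.mem_map.2 ⟨_, h, rfl⟩)
  have hF : ∀ {x φ}, (⟨x, φ⟩ : LabFormula m) ∈ s.fml → ⟨σ x, φ⟩ ∈ t.fml :=
    fun h => hs.2 (Multiset.mem_map.2 ⟨_, h, rfl⟩)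
  cases r with
  | id h h' => exact ⟨σ, _, .id (hF h) (hF h'), rfl, by simp⟩
  | and h => exact ⟨σ, _, .and (hF h), rfl, by simp [mapLabels]⟩
  | or h => exact ⟨σ, _, .or (hF h), rfl, by simp [mapLabels]⟩
  | @stit i w v φ h hv =>
    -- The old eigenvariable, or its image, may occur in `t`. It is sent to a label fresh for `t`
    -- instead, which leaves the relabelled conclusion unchanged because `v` does not occur in `s`.
    obtain ⟨v', -, hv'⟩ := exists_fresh t ∅
    have hw : w ≠ v := hv.2 _ h
    exact ⟨Function.update σ v v', _, .stit (hF h) hv', mapLabels_update hv v',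
      by simp [mapLabels, hw]⟩
  | @box w v φ h hv =>
    obtain ⟨v', -, hv'⟩ := exists_fresh t ∅
    exact ⟨Function.update σ v v', _, .box (hF h) hv', mapLabels_update hv v',
      by simp [mapLabels]⟩
  | @dia w u φ h => exact ⟨σ, _, .dia (u := σ u) (hF h), rfl, by simp [mapLabels]⟩
  | cstit h h' => exact ⟨σ, _, .cstit (hF h) (hR h'), rfl, by simp [mapLabels]⟩
  | refl i w => exact ⟨σ, _, .refl i (σ w), rfl, by simp [mapLabels]⟩
  | eucl h h' => exact ⟨σ, _, .eucl (hR h) (hR h'), rfl, by simp [mapLabels]⟩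
  | ioa u v hv hu =>
    -- The labels `σ (u i)` need not occur in `t`, so they must be avoided separately.
    obtain ⟨v', hv1, hv'⟩ := exists_fresh t (Finset.univ.image fun i => σ (u i))
    refine ⟨Function.update σ v v', _, .ioa (fun i => σ (u i)) v' hv' fun i h => hv1 ?_,
      mapLabels_update hv v', by simp [mapLabels, Function.comp_def, hu]⟩
    exact Finset.mem_image.2 ⟨i, Finset.mem_univ i, h⟩
  | apc hn i w =>
    refine ⟨σ, _, .apc hn i (fun k => σ (w k)), rfl, ?_⟩
    rintro _ ⟨k, j, hk, hj, rfl⟩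
    exact ⟨_, ⟨k, j, hk, hj, rfl⟩, by simp [mapLabels]⟩

/-- Height-preserving relabelling, weakening and contraction. -/
theorem Deriv.map {h : ℕ} {s : Sequent m} (d : Deriv n m h s) (σ : ℕ → ℕ) {t : Sequent m}
    (hs : Incl (s.mapLabels σ) t) : Deriv n m h t := by
  induction d generalizing σ t with
  | step r _ ih =>
    obtain ⟨σ', E', r', hσ, hE⟩ := r.map σ hs
    refine .step r' fun e' he' => ?_
    obtain ⟨e, he, rfl⟩ := hE e' he'
    refine ih e he σ' ?_
    rw [mapLabels_append, hσ]
    exact hs.append _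

theorem Deriv.sub {h : ℕ} {s t : Sequent m} (d : Deriv n m h s) (hs : Incl s t) :
    Deriv n m h t :=
  d.map _root_.id (by rwa [mapLabels_id])

theorem Deriv.mono {h h' : ℕ} {s : Sequent m} (d : Deriv n m h s) (hh : h ≤ h') :
    Deriv n m h' s := by
  induction d generalizing h' with
  | step r _ ih =>
    obtain ⟨k, rfl⟩ : ∃ k, h' = k + 1 := ⟨h' - 1, by omega⟩
    exact .step r fun p hp => ih p hp (by omega)

theorem incl_iff {s t : Sequent m} :
    Incl s t ↔ (∀ a, a ∈ s.rel → a ∈ t.rel) ∧ ∀ f, f ∈ s.fml → f ∈ t.fml := Iff.rfl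

@[simp, grind =]
theorem mem_append_rel {e s : Sequent m} {a : RelAtom m} :
    a ∈ (e.append s).rel ↔ a ∈ e.rel ∨ a ∈ s.rel := Multiset.mem_add

@[simp, grind =]
theorem mem_append_fml {e s : Sequent m} {f : LabFormula m} :
    f ∈ (e.append s).fml ↔ f ∈ e.fml ∨ f ∈ s.fml := Multiset.mem_add

attribute [grind =] incl_iff Multiset.insert_eq_cons Multiset.mem_cons Multiset.mem_singleton Multiset.mem_add
attribute [grind .] Multiset.notMem_zero

/-- The ways in which `f` can be principal in a rule instance with conclusion `R, f, Γ`. -/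
def Principal (R : Multiset (RelAtom m)) (Γ : Multiset (LabFormula m)) (E : Set (Sequent m))
    (w : ℕ) : Formula m → Prop
  | .pos p => ⟨w, neg p⟩ ∈ Γ
  | .neg p => ⟨w, pos p⟩ ∈ Γ
  | .and φ ψ => E = {⟨0, {⟨w, φ⟩}⟩, ⟨0, {⟨w, ψ⟩}⟩}
  | .or φ ψ => E = {⟨0, {⟨w, φ⟩, ⟨w, ψ⟩}⟩}
  | .stit i φ => ∃ v, Fresh v ⟨R, ⟨w, stit i φ⟩ ::ₘ Γ⟩ ∧ E = {⟨{⟨i, w, v⟩}, {⟨v, φ⟩}⟩}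
  | .box φ => ∃ v, Fresh v ⟨R, ⟨w, box φ⟩ ::ₘ Γ⟩ ∧ E = {⟨0, {⟨v, φ⟩}⟩}
  | .dia φ => ∃ u, E = {⟨0, {⟨u, φ⟩}⟩}
  | .cstit i φ => ∃ u, ⟨i, w, u⟩ ∈ R ∧ E = {⟨0, {⟨u, φ⟩}⟩}

theorem incl_cons (R : Multiset (RelAtom m)) (Γ : Multiset (LabFormula m)) (f : LabFormula m) :
    Incl ⟨R, Γ⟩ ⟨R, f ::ₘ Γ⟩ :=
  ⟨fun _ h => h, fun _ h => Multiset.mem_cons_of_mem h⟩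

/-- A rule instance either does not use a given formula or has it as principal formula. -/
theorem Step.strengthen_or_principal {R : Multiset (RelAtom m)} {Γ : Multiset (LabFormula m)}
    {E : Set (Sequent m)} {x : ℕ} {χ : Formula m} (r : Step n m ⟨R, ⟨x, χ⟩ ::ₘ Γ⟩ E) :
    Step n m ⟨R, Γ⟩ E ∨ Principal R Γ E x χ := by
  have key : ∀ {w φ}, (⟨w, φ⟩ : LabFormula m) ∈ ⟨x, χ⟩ ::ₘ Γ → (w = x ∧ φ = χ) ∨ ⟨w, φ⟩ ∈ Γ := by
    intro w φ h
    simpa using h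
  have fr : ∀ {v}, Fresh v ⟨R, ⟨x, χ⟩ ::ₘ Γ⟩ → Fresh v ⟨R, Γ⟩ := fun h => h.mono (incl_cons _ _ _)
  cases r with
  | id h h' =>
    rcases key h with ⟨rfl, rfl⟩ | h₁
    · rcases key h' with ⟨_, h'⟩ | h'
      · cases h'
      · exact .inr h'
    · rcases key h' with ⟨rfl, rfl⟩ | h'
      · exact .inr h₁
      · exact .inl (.id h₁ h')
  | and h =>
    rcases key h with ⟨rfl, rfl⟩ | h
    · exact .inr rfl
    · exact .inl (.and h)
  | or h =>
    rcases key h with ⟨rfl, rfl⟩ | h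
    · exact .inr rfl
    · exact .inl (.or h)
  | stit h hv =>
    rcases key h with ⟨rfl, rfl⟩ | h
    · exact .inr ⟨_, hv, rfl⟩
    · exact .inl (.stit h (fr hv))
  | box h hv =>
    rcases key h with ⟨rfl, rfl⟩ | h
    · exact .inr ⟨_, hv, rfl⟩
    · exact .inl (.box h (fr hv))
  | dia h =>
    rcases key h with ⟨rfl, rfl⟩ | h
    · exact .inr ⟨_, rfl⟩
    · exact .inl (.dia h)
  | cstit h h' =>
    rcases key h with ⟨rfl, rfl⟩ | h
    · exact .inr ⟨_, h', rfl⟩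
    · exact .inl (.cstit h h')
  | refl i w => exact .inl (.refl i w)
  | eucl h h' => exact .inl (.eucl h h')
  | ioa u v hv hu => exact .inl (.ioa u v (fr hv) hu)
  | apc hn i w => exact .inl (.apc hn i w)

theorem append_incl_iff {e s t : Sequent m} : Incl (e.append s) t ↔ Incl e t ∧ Incl s t := by
  grind

theorem incl_append_right (e s : Sequent m) : Incl s (e.append s) :=
  (append_incl_iff.1 (Incl.refl _)).2

theorem append_cons_fml (e : Sequent m) (R : Multiset (RelAtom m)) (Γ : Multiset (LabFormula m))
    (f : LabFormula m) :
    e.append ⟨R, f ::ₘ Γ⟩ = ⟨e.rel + R, f ::ₘ (e.fml + Γ)⟩ := by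
  simp [append]

/-- A formula `[i]φ` is superfluous beside an instance of its premise. -/
theorem Deriv.stit_elim {h : ℕ} {R : Multiset (RelAtom m)} {Γ : Multiset (LabFormula m)}
    {w v : ℕ} {i : Fin m} {φ : Formula m} (d : Deriv n m h ⟨R, ⟨w, stit i φ⟩ ::ₘ Γ⟩)
    (hR : ⟨i, w, v⟩ ∈ R) (hΓ : ⟨v, φ⟩ ∈ Γ) : Deriv n m h ⟨R, Γ⟩ := by
  induction h generalizing R Γ with
  | zero => cases d
  | succ h ih =>
    cases d with
    | @step _ _ E r d =>
    have ih' : ∀ e ∈ E, Deriv n m h (e.append ⟨R, Γ⟩) := fun e he =>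
      ih (append_cons_fml _ _ _ _ ▸ d e he) (Multiset.mem_add.2 (.inr hR))
        (Multiset.mem_add.2 (.inr hΓ))
    rcases r.strengthen_or_principal with r | ⟨u, hu, rfl⟩
    · exact .step r ih'
    · have hu' : Fresh u ⟨R, Γ⟩ := hu.mono (incl_cons _ _ _)
      have hw : w ≠ u := hu.2 _ (Multiset.mem_cons_self _ _)
      -- When `[i]φ` is principal, identifying the eigenvariable `u` with `v` turns the added atom
      -- and formula into the given members `hR` and `hΓ`, so the rule instance disappears.
      refine Deriv.mono ((ih' _ rfl).map (Function.update _root_.id u v) ?_) (Nat.le_succ h)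
      rw [mapLabels_append, mapLabels_update hu', mapLabels_id]
      refine append_incl_iff.2 ⟨?_, Incl.refl _⟩
      simpa [Incl, mapLabels, hw] using ⟨hR, hΓ⟩

/-! ### Height-preserving equivalence with the multiset calculus -/

theorem DerivableIn.deriv {h : ℕ} {s : Sequent m} (d : DerivableIn n m h s) : Deriv n m h s := by
  induction d with
  | step r _ ih =>
    cases r with
    | id R Γ w p => exact .step (.id (w := w) (p := p) (by simp) (by simp)) (by simp)
    | and R Γ w φ ψ =>
      refine .step (.and (w := w) (φ := φ) (ψ := ψ) (by simp)) ?_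
      rintro _ (rfl | rfl)
      · exact (ih _ (.inl rfl)).sub (by grind)
      · exact (ih _ (.inr rfl)).sub (by grind)
    | or R Γ w φ ψ =>
      refine .step (.or (w := w) (φ := φ) (ψ := ψ) (by simp)) ?_
      rintro _ rfl
      exact (ih _ rfl).sub (by grind)
    | stit R Γ i w v φ hv =>
      refine .step (.stit (i := i) (w := w) (v := v) (φ := φ) (by simp) hv) ?_
      rintro _ rfl
      exact (ih _ rfl).sub (by grind)
    | box R Γ w v φ hv =>
      refine .step (.box (w := w) (v := v) (φ := φ) (by simp) hv) ?_
      rintro _ rfl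
      exact (ih _ rfl).sub (by grind)
    | dia R Γ w u φ =>
      refine .step (.dia (w := w) (u := u) (φ := φ) (by simp)) ?_
      rintro _ rfl
      exact (ih _ rfl).sub (by grind)
    | cstit R Γ i w u φ =>
      refine .step (.cstit (i := i) (w := w) (u := u) (φ := φ) (by simp) (by simp)) ?_
      rintro _ rfl
      exact (ih _ rfl).sub (by grind)
    | refl R Γ i w =>
      refine .step (.refl i w) ?_
      rintro _ rfl
      exact (ih _ rfl).sub (by grind)
    | eucl R Γ i w u v =>
      refine .step (.eucl (i := i) (w := w) (u := u) (v := v) (by simp) (by simp)) ?_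
      rintro _ rfl
      exact (ih _ rfl).sub (by grind)
    | ioa R Γ u v hv hu =>
      refine .step (.ioa u v hv hu) ?_
      rintro _ rfl
      exact (ih _ rfl).sub (by simp [Incl, append])
    | apc hn R Γ i w =>
      refine .step (.apc hn i w) ?_
      rintro _ ⟨k, j, hk, hj, rfl⟩
      exact (ih _ ⟨k, j, hk, hj, rfl⟩).sub (by grind)

theorem Deriv.derivableIn {h : ℕ} {s : Sequent m} (d : Deriv n m h s) : DerivableIn n m h s := by
  induction h generalizing s with
  | zero => cases d
  | succ h ih =>
    obtain ⟨R, Γ⟩ := s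
    cases d with
    | step r d =>
    cases r with
    | @id w p h₁ h₂ =>
      obtain ⟨Γ, rfl⟩ := Multiset.exists_cons_of_mem h₁
      obtain ⟨Γ, rfl⟩ := Multiset.exists_cons_of_mem ((Multiset.mem_cons.1 h₂).resolve_left (by simp))
      exact .step (.id R Γ w p) (by simp)
    | @and w φ ψ h₁ =>
      obtain ⟨Γ, rfl⟩ := Multiset.exists_cons_of_mem h₁
      refine .step (.and R Γ w φ ψ) ?_
      rintro _ (rfl | rfl)
      · exact ih ((d _ (.inl rfl)).sub (by grind))
      · exact ih ((d _ (.inr rfl)).sub (by grind))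
    | @or w φ ψ h₁ =>
      obtain ⟨Γ, rfl⟩ := Multiset.exists_cons_of_mem h₁
      refine .step (.or R Γ w φ ψ) ?_
      rintro _ rfl
      exact ih ((d _ rfl).sub (by grind))
    | @stit i w v φ h₁ hv =>
      obtain ⟨Γ, rfl⟩ := Multiset.exists_cons_of_mem h₁
      refine .step (.stit R Γ i w v φ hv) ?_
      rintro _ rfl
      have d' := d _ rfl
      -- The cumulative premise still contains `[i]φ`, which the original rule discards.
      rw [append_cons_fml] at d'
      refine ih ((d'.stit_elim (v := v) (by simp) (by simp)).sub ?_)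
      grind
    | @box w v φ h₁ hv =>
      obtain ⟨Γ, rfl⟩ := Multiset.exists_cons_of_mem h₁
      refine .step (.box R Γ w v φ hv) ?_
      rintro _ rfl
      exact ih ((d _ rfl).sub (by grind))
    | @dia w u φ h₁ =>
      obtain ⟨Γ, rfl⟩ := Multiset.exists_cons_of_mem h₁
      refine .step (.dia R Γ w u φ) ?_
      rintro _ rfl
      exact ih ((d _ rfl).sub (by grind))
    | @cstit i w u φ h₁ h₂ =>
      obtain ⟨Γ, rfl⟩ := Multiset.exists_cons_of_mem h₁
      obtain ⟨R, rfl⟩ := Multiset.exists_cons_of_mem h₂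
      refine .step (.cstit R Γ i w u φ) ?_
      rintro _ rfl
      exact ih ((d _ rfl).sub (by grind))
    | refl i w =>
      refine .step (.refl R Γ i w) ?_
      rintro _ rfl
      exact ih ((d _ rfl).sub (by grind))
    | @eucl i w u v h₁ h₂ =>
      -- Here the two memberships may refer to a single copy of the atom, while the multiset rule
      -- needs two. The atom to be added is then reflexive, so `refl` serves.
      by_cases huv : v = u
      · subst huv
        refine .step (.refl R Γ i v) ?_
        rintro _ rfl
        exact ih ((d _ rfl).sub (by grind))
      obtain ⟨R, rfl⟩ := Multiset.exists_cons_of_mem h₁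
      obtain ⟨R, rfl⟩ := Multiset.exists_cons_of_mem
        ((Multiset.mem_cons.1 h₂).resolve_left (by simpa using huv))
      refine .step (.eucl R Γ i w u v) ?_
      rintro _ rfl
      exact ih ((d _ rfl).sub (by grind))
    | ioa u v hv hu =>
      refine .step (.ioa R Γ u v hv hu) ?_
      rintro _ rfl
      exact ih ((d _ rfl).sub (by grind))
    | apc hn i w =>
      refine .step (.apc hn R Γ i w) ?_
      rintro _ ⟨k, j, hk, hj, rfl⟩
      exact ih ((d _ ⟨k, j, hk, hj, rfl⟩).sub (by grind))

theorem derivableIn_iff {h : ℕ} {s : Sequent m} : DerivableIn n m h s ↔ Deriv n m h s :=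
  ⟨DerivableIn.deriv, Deriv.derivableIn⟩

theorem DerivableIn.sub {h : ℕ} {s t : Sequent m} (d : DerivableIn n m h s) (hs : Incl s t) :
    DerivableIn n m h t :=
  (d.deriv.sub hs).derivableIn

theorem DerivableIn.mapLabels {h : ℕ} {s : Sequent m} (d : DerivableIn n m h s) (σ : ℕ → ℕ) :
    DerivableIn n m h (s.mapLabels σ) :=
  (d.deriv.map σ (Incl.refl _)).derivableIn

/-- All premises except that of `[i]` include their conclusion, so weakening suffices. For `[i]`,
weaken by the instance and then drop the principal formula. -/
theorem Rule.premise_derivableIn {h : ℕ} {prems : Set (Sequent m)} {c : Sequent m}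
    (r : Rule n m prems c) (d : DerivableIn n m h c) : ∀ p ∈ prems, DerivableIn n m h p := by
  intro p hp
  cases r with
  | id => exact absurd hp (by simp)
  | and => rcases hp with rfl | rfl <;> exact d.sub (by grind)
  | stit R Γ i w v φ hv =>
    cases hp
    refine (Deriv.stit_elim (d.deriv.sub (t := ⟨_, ⟨w, .stit i φ⟩ ::ₘ ⟨v, φ⟩ ::ₘ Γ⟩) ?_)
      (Multiset.mem_cons_self _ _) (Multiset.mem_cons_self _ _)).derivableIn
    grind
  | apc =>
    obtain ⟨k, j, -, -, rfl⟩ := hp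
    exact d.sub (by grind)
  | ioa => cases hp; exact d.sub (by grind)
  | _ => cases hp; exact d.sub (by grind)

/-- Needed to bound the heights of all premises at once in `Derivable.of_step`. -/
theorem Step.finite {s : Sequent m} {E : Set (Sequent m)} (r : Step n m s E) : E.Finite := by
  cases r with
  | apc hn i w =>
    refine (((Set.finite_Iic n).prod (Set.finite_Iic n)).image fun a : ℕ × ℕ =>
      (⟨{⟨i, w a.1, w a.2⟩}, 0⟩ : Sequent m)).subset ?_
    rintro _ ⟨k, j, hk, hj, rfl⟩
    exact ⟨(k, j), ⟨(hk.trans_le hj).le, hj⟩, rfl⟩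
  | _ => simp

theorem derivable_iff {s : Sequent m} : Derivable n m s ↔ ∃ h, Deriv n m h s := by
  simp [Derivable, derivableIn_iff]

/-! ### Derived rules, generalized identity and inversion -/

namespace Derivable

variable {R : Multiset (RelAtom m)} {Γ : Multiset (LabFormula m)}

theorem map {s t : Sequent m} (d : Derivable n m s) (σ : ℕ → ℕ) (hs : Incl (s.mapLabels σ) t) :
    Derivable n m t := by
  obtain ⟨h, d⟩ := derivable_iff.1 d
  exact derivable_iff.2 ⟨h, d.map σ hs⟩

theorem sub {s t : Sequent m} (d : Derivable n m s) (hs : Incl s t) : Derivable n m t :=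
  d.map _root_.id (by rwa [mapLabels_id])

theorem of_step {s : Sequent m} {E : Set (Sequent m)} (r : Step n m s E)
    (d : ∀ e ∈ E, Derivable n m (e.append s)) : Derivable n m s := by
  simp only [derivable_iff] at d ⊢
  choose! f hf using d
  obtain ⟨b, hb⟩ := (r.finite.image f).bddAbove
  exact ⟨b + 1, .step r fun e he => (hf e he).mono (hb ⟨e, he, rfl⟩)⟩

theorem and {w : ℕ} {φ ψ : Formula m} (h : ⟨w, .and φ ψ⟩ ∈ Γ) (d : Derivable n m ⟨R, ⟨w, φ⟩ ::ₘ Γ⟩)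
    (d' : Derivable n m ⟨R, ⟨w, ψ⟩ ::ₘ Γ⟩) : Derivable n m ⟨R, Γ⟩ := by
  refine of_step (.and h) ?_
  rintro _ (rfl | rfl)
  · exact d.sub (by grind)
  · exact d'.sub (by grind)

theorem or {w : ℕ} {φ ψ : Formula m} (h : ⟨w, .or φ ψ⟩ ∈ Γ)
    (d : Derivable n m ⟨R, ⟨w, φ⟩ ::ₘ ⟨w, ψ⟩ ::ₘ Γ⟩) : Derivable n m ⟨R, Γ⟩ := by
  refine of_step (.or h) ?_
  rintro _ rfl
  exact d.sub (by grind)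

/-- Asking for the premise at every label hides the choice of a fresh eigenvariable from later
derivations. -/
theorem stit {i : Fin m} {w : ℕ} {φ : Formula m} (h : ⟨w, .stit i φ⟩ ∈ Γ)
    (d : ∀ v, Derivable n m ⟨⟨i, w, v⟩ ::ₘ R, ⟨v, φ⟩ ::ₘ Γ⟩) : Derivable n m ⟨R, Γ⟩ := by
  obtain ⟨v, -, hv⟩ := exists_fresh ⟨R, Γ⟩ ∅
  refine of_step (.stit h hv) ?_
  rintro _ rfl
  exact (d v).sub (by grind)

theorem box {w : ℕ} {φ : Formula m} (h : ⟨w, .box φ⟩ ∈ Γ)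
    (d : ∀ v, Derivable n m ⟨R, ⟨v, φ⟩ ::ₘ Γ⟩) : Derivable n m ⟨R, Γ⟩ := by
  obtain ⟨v, -, hv⟩ := exists_fresh ⟨R, Γ⟩ ∅
  refine of_step (.box h hv) ?_
  rintro _ rfl
  exact (d v).sub (by grind)

theorem dia {w u : ℕ} {φ : Formula m} (h : ⟨w, .dia φ⟩ ∈ Γ)
    (d : Derivable n m ⟨R, ⟨u, φ⟩ ::ₘ Γ⟩) : Derivable n m ⟨R, Γ⟩ := by
  refine of_step (.dia (u := u) h) ?_
  rintro _ rfl
  exact d.sub (by grind)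

theorem cstit {i : Fin m} {w u : ℕ} {φ : Formula m} (h : ⟨w, .cstit i φ⟩ ∈ Γ) (h' : ⟨i, w, u⟩ ∈ R)
    (d : Derivable n m ⟨R, ⟨u, φ⟩ ::ₘ Γ⟩) : Derivable n m ⟨R, Γ⟩ := by
  refine of_step (.cstit h h') ?_
  rintro _ rfl
  exact d.sub (by grind)

theorem refl (i : Fin m) (w : ℕ) (d : Derivable n m ⟨⟨i, w, w⟩ ::ₘ R, Γ⟩) :
    Derivable n m ⟨R, Γ⟩ := by
  refine of_step (.refl i w) ?_
  rintro _ rfl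
  exact d.sub (by grind)

theorem eucl {i : Fin m} {w u v : ℕ} (h : ⟨i, w, u⟩ ∈ R) (h' : ⟨i, w, v⟩ ∈ R)
    (d : Derivable n m ⟨⟨i, u, v⟩ ::ₘ R, Γ⟩) : Derivable n m ⟨R, Γ⟩ := by
  refine of_step (.eucl h h') ?_
  rintro _ rfl
  exact d.sub (by grind)

theorem ioa (u : Fin m → ℕ)
    (d : ∀ v R', R ⊆ R' → (∀ i, ⟨i, u i, v⟩ ∈ R') → Derivable n m ⟨R', Γ⟩) :
    Derivable n m ⟨R, Γ⟩ := by
  obtain ⟨v, hu, hv⟩ := exists_fresh ⟨R, Γ⟩ (Finset.univ.image u)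
  refine of_step (.ioa u v hv fun i h => hu (Finset.mem_image.2 ⟨i, Finset.mem_univ i, h⟩)) ?_
  rintro _ rfl
  refine (d v _ (fun _ h => Multiset.mem_add.2 (.inr h)) fun i => Multiset.mem_add.2 (.inl ?_)).sub
    ⟨fun _ h => h, (incl_append_right _ _).2⟩
  exact Multiset.mem_map.2 ⟨i, Finset.mem_univ_val i, rfl⟩

theorem apc (hn : 0 < n) (i : Fin m) (w : ℕ → ℕ)
    (d : ∀ k j, k < j → j ≤ n → Derivable n m ⟨⟨i, w k, w j⟩ ::ₘ R, Γ⟩) :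
    Derivable n m ⟨R, Γ⟩ := by
  refine of_step (.apc hn i w) ?_
  rintro _ ⟨k, j, hk, hj, rfl⟩
  exact (d k j hk hj).sub (by grind)

/-- Generalized identity sequents are derivable. -/
theorem identity {w : ℕ} {φ : Formula m} (h : ⟨w, φ⟩ ∈ Γ) (h' : ⟨w, φ.not⟩ ∈ Γ) :
    Derivable n m ⟨R, Γ⟩ := by
  induction φ generalizing R Γ w with
  | pos p => exact of_step (.id h h') (by simp)
  | neg p => exact of_step (.id h' h) (by simp)
  | and φ ψ ihφ ihψ =>
    refine or h' ?_
    exact and (w := w) (φ := φ) (ψ := ψ) (by grind) (ihφ (w := w) (by grind) (by grind))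
      (ihψ (w := w) (by grind) (by grind))
  | or φ ψ ihφ ihψ =>
    refine or h ?_
    exact and (w := w) (φ := φ.not) (ψ := ψ.not) (by simp only [Formula.not] at h'; grind)
      (ihφ (w := w) (by grind) (by grind)) (ihψ (w := w) (by grind) (by grind))
  | box φ ih =>
    exact box h fun v => dia (u := v) (Multiset.mem_cons_of_mem h') (ih (w := v) (by grind) (by grind))
  | dia φ ih =>
    exact box h' fun v => dia (u := v) (Multiset.mem_cons_of_mem h) (ih (w := v) (by grind) (by grind))
  | stit i φ ih =>
    exact stit h fun v => cstit (u := v) (Multiset.mem_cons_of_mem h') (by grind)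
      (ih (w := v) (by grind) (by grind))
  | cstit i φ ih =>
    exact stit h' fun v => cstit (u := v) (Multiset.mem_cons_of_mem h) (by grind)
      (ih (w := v) (by grind) (by grind))

/-- A formula can be removed from a derivable sequent if it can be removed from every rule
instance in which it is principal. -/
theorem remove {x : ℕ} {χ : Formula m} (d : Derivable n m ⟨R, ⟨x, χ⟩ ::ₘ Γ⟩)
    (H : ∀ R' Γ' E, R ⊆ R' → Γ ⊆ Γ' → Principal R' Γ' E x χ →
      (∀ e ∈ E, Derivable n m (e.append ⟨R', Γ'⟩)) → Derivable n m ⟨R', Γ'⟩) :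
    Derivable n m ⟨R, Γ⟩ := by
  obtain ⟨h, d⟩ := derivable_iff.1 d
  induction h generalizing R Γ with
  | zero => cases d
  | succ h ih =>
    cases d with
    | @step _ _ E r d =>
    have ih' : ∀ e ∈ E, Derivable n m (e.append ⟨R, Γ⟩) := by
      intro e he
      have d := d e he
      rw [append_cons_fml] at d
      -- Contexts grow towards the leaves, which is why `H` is stated for all larger contexts.
      exact ih (derivable_iff.2 ⟨h, d⟩) (fun R' Γ' E' hR hΓ => H R' Γ' E'
        (fun a ha => hR (Multiset.mem_add.2 (.inr ha)))
        fun a ha => hΓ (Multiset.mem_add.2 (.inr ha))) d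
    rcases r.strengthen_or_principal with r | hP
    · exact of_step r ih'
    · exact H R Γ E (fun _ h => h) (fun _ h => h) hP ih'

theorem and_left {x : ℕ} {φ ψ : Formula m} (d : Derivable n m ⟨R, ⟨x, .and φ ψ⟩ ::ₘ Γ⟩) :
    Derivable n m ⟨R, ⟨x, φ⟩ ::ₘ Γ⟩ := by
  refine remove (x := x) (χ := .and φ ψ) (d.sub (by grind)) ?_
  rintro R' Γ' _ hR hΓ rfl hE
  have := hΓ (Multiset.mem_cons_self _ _)
  exact (hE _ (.inl rfl)).sub (by grind)

theorem and_right {x : ℕ} {φ ψ : Formula m} (d : Derivable n m ⟨R, ⟨x, .and φ ψ⟩ ::ₘ Γ⟩) :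
    Derivable n m ⟨R, ⟨x, ψ⟩ ::ₘ Γ⟩ := by
  refine remove (x := x) (χ := .and φ ψ) (d.sub (by grind)) ?_
  rintro R' Γ' _ hR hΓ rfl hE
  have := hΓ (Multiset.mem_cons_self _ _)
  exact (hE _ (.inr rfl)).sub (by grind)

theorem or_inv {x : ℕ} {φ ψ : Formula m} (d : Derivable n m ⟨R, ⟨x, .or φ ψ⟩ ::ₘ Γ⟩) :
    Derivable n m ⟨R, ⟨x, φ⟩ ::ₘ ⟨x, ψ⟩ ::ₘ Γ⟩ := by
  refine remove (x := x) (χ := .or φ ψ) (d.sub (by grind)) ?_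
  rintro R' Γ' _ hR hΓ rfl hE
  have h1 := hΓ (Multiset.mem_cons_self _ _)
  have h2 := hΓ (Multiset.mem_cons_of_mem (Multiset.mem_cons_self _ _))
  exact (hE _ rfl).sub (by grind)

/-- Wherever `□φ` is principal, its eigenvariable can be identified with `u`, and the added formula
is then already present. -/
theorem box_inv {x : ℕ} {φ : Formula m} (d : Derivable n m ⟨R, ⟨x, .box φ⟩ ::ₘ Γ⟩) (u : ℕ) :
    Derivable n m ⟨R, ⟨u, φ⟩ ::ₘ Γ⟩ := by
  refine remove (x := x) (χ := .box φ) (d.sub (by grind)) ?_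
  rintro R' Γ' _ hR hΓ ⟨v, hv, rfl⟩ hE
  have h1 := hΓ (Multiset.mem_cons_self _ _)
  refine (hE _ rfl).map (Function.update _root_.id v u) ?_
  rw [mapLabels_append, mapLabels_update (hv.mono (incl_cons _ _ _)), mapLabels_id]
  refine append_incl_iff.2 ⟨?_, Incl.refl _⟩
  simpa [Incl, mapLabels] using h1

theorem stit_inv {i : Fin m} {x : ℕ} {φ : Formula m}
    (d : Derivable n m ⟨R, ⟨x, .stit i φ⟩ ::ₘ Γ⟩) {u : ℕ} (hu : ⟨i, x, u⟩ ∈ R) :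
    Derivable n m ⟨R, ⟨u, φ⟩ ::ₘ Γ⟩ := by
  obtain ⟨h, d⟩ := derivable_iff.1 d
  refine derivable_iff.2 ⟨h, (d.sub ?_).stit_elim hu (Multiset.mem_cons_self _ _)⟩
  grind

end Derivable

/-! ### Cut elimination -/

/-- Cuts on the formula `φ` are admissible. -/
def CutAdmissible (n : ℕ) (φ : Formula m) : Prop :=
  ∀ (R : Multiset (RelAtom m)) (Γ : Multiset (LabFormula m)) (x : ℕ),
    Derivable n m ⟨R, ⟨x, φ⟩ ::ₘ Γ⟩ → Derivable n m ⟨R, ⟨x, φ.not⟩ ::ₘ Γ⟩ →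
      Derivable n m ⟨R, Γ⟩

namespace CutAdmissible

theorem not {φ : Formula m} (h : CutAdmissible n φ) : CutAdmissible n φ.not :=
  fun R Γ x d d' => h R Γ x (by rwa [Formula.not_not] at d') d

theorem pos (p : ℕ) : CutAdmissible n (.pos p : Formula m) := by
  intro R Γ x d d'
  refine d.remove ?_
  intro R' Γ' E hR hΓ hP _
  have hP : (⟨x, .neg p⟩ : LabFormula m) ∈ Γ' := hP
  refine d'.sub ⟨hR, fun f hf => ?_⟩
  rcases Multiset.mem_cons.1 hf with rfl | hf
  exacts [hP, hΓ hf]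

theorem and {φ ψ : Formula m} (hφ : CutAdmissible n φ) (hψ : CutAdmissible n ψ) :
    CutAdmissible n (.and φ ψ) := by
  intro R Γ x d d'
  have d' : Derivable n m ⟨R, ⟨x, .or φ.not ψ.not⟩ ::ₘ Γ⟩ := d'
  exact hφ R Γ x d.and_left
    (hψ R _ x (d.and_right.sub (by grind)) (d'.or_inv.sub (by grind)))

/-- At each step of the second derivation that instantiates the dual `◇` at some `u`, the first
derivation is inverted at that same `u`, leaving a cut on `φ`. The case of `[i]` is the same, the
atom needed for inversion coming from the `⟨i⟩` rule. -/
theorem box {φ : Formula m} (hφ : CutAdmissible n φ) : CutAdmissible n (.box φ) := by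
  intro R Γ x d d'
  have d' : Derivable n m ⟨R, ⟨x, .dia φ.not⟩ ::ₘ Γ⟩ := d'
  refine d'.remove ?_
  rintro R' Γ' _ hR hΓ ⟨u, rfl⟩ hE
  refine hφ R' Γ' u ((d.box_inv u).sub ⟨hR, ?_⟩) ((hE _ rfl).sub (by grind))
  grind [Multiset.subset_iff]

theorem stit {i : Fin m} {φ : Formula m} (hφ : CutAdmissible n φ) :
    CutAdmissible n (.stit i φ) := by
  intro R Γ x d d'
  have d' : Derivable n m ⟨R, ⟨x, .cstit i φ.not⟩ ::ₘ Γ⟩ := d'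
  refine d'.remove ?_
  rintro R' Γ' _ hR hΓ ⟨u, hu, rfl⟩ hE
  refine hφ R' Γ' u (Derivable.stit_inv (x := x) (i := i) (d.sub ⟨hR, ?_⟩) hu) ((hE _ rfl).sub (by grind))
  grind [Multiset.subset_iff]

end CutAdmissible

theorem cutAdmissible (φ : Formula m) : CutAdmissible n φ := by
  induction φ with
  | pos p => exact .pos p
  | neg p => exact (CutAdmissible.pos p).not
  | and φ ψ hφ hψ => exact hφ.and hψ
  | or φ ψ hφ hψ => simpa [Formula.not] using (hφ.not.and hψ.not).not
  | box φ hφ => exact hφ.box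
  | dia φ hφ => simpa [Formula.not] using hφ.not.box.not
  | stit i φ hφ => exact hφ.stit
  | cstit i φ hφ => simpa [Formula.not] using (hφ.not.stit (i := i)).not

/-! ### Sequent derivations of the Hilbert axioms -/

namespace Derivable

variable {R : Multiset (RelAtom m)} {Γ : Multiset (LabFormula m)}

theorem imp {w : ℕ} {φ ψ : Formula m} (h : ⟨w, .imp φ ψ⟩ ∈ Γ)
    (d : Derivable n m ⟨R, ⟨w, φ.not⟩ ::ₘ ⟨w, ψ⟩ ::ₘ Γ⟩) : Derivable n m ⟨R, Γ⟩ :=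
  or h d

/-- Reflexivity at `x` and one Euclidean step give the atom from `y` to `x`; a second step, at `y`,
gives the one from `x` to `z`. -/
theorem trans {i : Fin m} {x y z : ℕ} (h : ⟨i, x, y⟩ ∈ R) (h' : ⟨i, y, z⟩ ∈ R)
    (d : ∀ R', R ⊆ R' → ⟨i, x, z⟩ ∈ R' → Derivable n m ⟨R', Γ⟩) : Derivable n m ⟨R, Γ⟩ := by
  refine refl i x (eucl (i := i) (w := x) (u := y) (v := x) (by grind) (by grind) ?_)
  refine eucl (i := i) (w := y) (u := x) (v := z) (by grind) (by grind) (d _ ?_ (by grind))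
  grind [Multiset.subset_iff]

theorem conj {w : ℕ} {l : List (Formula m)} (h : ⟨w, Formula.conj l⟩ ∈ Γ)
    (d : ∀ φ ∈ l, Derivable n m ⟨R, ⟨w, φ⟩ ::ₘ Γ⟩) : Derivable n m ⟨R, Γ⟩ := by
  induction l generalizing Γ with
  | nil => exact or h (identity (w := w) (φ := .pos 0) (by grind) (by grind [Formula.not]))
  | cons φ l ih =>
    cases l with
    | nil => exact (d φ (by simp)).sub (by grind [Formula.conj])
    | cons ψ l =>
      refine and h (d φ (by simp)) (ih (by grind) fun χ hχ => ?_)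
      exact (d χ (List.mem_cons_of_mem _ hχ)).sub (by grind)

theorem conj_not {w : ℕ} {l : List (Formula m)} (h : ⟨w, (Formula.conj l).not⟩ ∈ Γ)
    (d : ∀ Γ', Γ ⊆ Γ' → (∀ φ ∈ l, ⟨w, φ.not⟩ ∈ Γ') → Derivable n m ⟨R, Γ'⟩) :
    Derivable n m ⟨R, Γ⟩ := by
  induction l generalizing Γ with
  | nil => exact d Γ (fun _ h => h) (by simp)
  | cons φ l ih =>
    cases l with
    | nil => exact d Γ (fun _ h => h) (by simpa [Formula.conj, Formula.disj] using h)
    | cons ψ l =>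
      refine or h (ih (by grind) fun Γ' hΓ hl => d Γ' ?_ ?_)
      · grind [Multiset.subset_iff]
      · grind [Multiset.subset_iff]

theorem disj {w : ℕ} {l : List (Formula m)} (h : ⟨w, Formula.disj l⟩ ∈ Γ)
    (d : ∀ Γ', Γ ⊆ Γ' → (∀ φ ∈ l, ⟨w, φ⟩ ∈ Γ') → Derivable n m ⟨R, Γ'⟩) :
    Derivable n m ⟨R, Γ⟩ := by
  induction l generalizing Γ with
  | nil => exact d Γ (fun _ h => h) (by simp)
  | cons φ l ih =>
    cases l with
    | nil => exact d Γ (fun _ h => h) (by simpa [Formula.conj, Formula.disj] using h)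
    | cons ψ l =>
      refine or h (ih (by grind) fun Γ' hΓ hl => d Γ' ?_ ?_)
      · grind [Multiset.subset_iff]
      · grind [Multiset.subset_iff]

theorem boxes {ι : Type*} [DecidableEq ι] (s : Finset ι) {w : ℕ} {ψ : ι → Formula m}
    (h : ∀ i ∈ s, ⟨w, .box (ψ i)⟩ ∈ Γ)
    (d : ∀ Γ' (u : ι → ℕ), Γ ⊆ Γ' → (∀ i ∈ s, ⟨u i, ψ i⟩ ∈ Γ') → Derivable n m ⟨R, Γ'⟩) :
    Derivable n m ⟨R, Γ⟩ := by
  induction s using Finset.induction_on generalizing Γ with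
  | empty => exact d Γ (fun _ => 0) (fun _ h => h) (by simp)
  | insert a s ha ih =>
    refine box (h a (Finset.mem_insert_self a s)) fun v => ih ?_ fun Γ' u hΓ hu => ?_
    · exact fun i hi => Multiset.mem_cons_of_mem (h i (Finset.mem_insert_of_mem hi))
    · refine d Γ' (Function.update u a v) (by grind [Multiset.subset_iff]) fun i hi => ?_
      rcases eq_or_ne i a with rfl | hia
      · simpa using hΓ (Multiset.mem_cons_self _ _)
      · simpa [hia] using hu i (Finset.mem_of_mem_insert_of_ne hi hia)

/-- The labels `u i` refute the antecedent's diamonds, and `v` is a common successor of them all.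
Any `i`-successor of `v` is by transitivity one of `u i`, where the `⟨i⟩` formula closes the branch.
-/
theorem ioa_axiom {w : ℕ} (φ : Fin m → Formula m)
    (h : ⟨w, .imp (Formula.conj (List.ofFn fun i => .dia (.stit i (φ i))))
      (.dia (Formula.conj (List.ofFn fun i => .stit i (φ i))))⟩ ∈ Γ) :
    Derivable n m ⟨R, Γ⟩ := by
  refine imp h (conj_not (Multiset.mem_cons_self _ _) fun Γ₁ h₁ hb => ?_)
  have hd := h₁ (Multiset.mem_cons_of_mem (Multiset.mem_cons_self _ _))
  refine boxes Finset.univ (w := w) (ψ := fun i => .cstit i (φ i).not) (fun i _ => ?_)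
    fun Γ₂ u h₂ hu => ioa u fun v R' _ hv => ?_
  · exact hb (.dia (.stit i (φ i))) (by simp)
  refine dia (u := v) (h₂ hd) (conj (Multiset.mem_cons_self _ _) fun χ hχ => ?_)
  obtain ⟨i, rfl⟩ := (List.mem_ofFn' _ _).1 hχ
  refine stit (Multiset.mem_cons_self _ _) fun x => ?_
  refine trans (i := i) (x := u i) (y := v) (z := x) (by grind) (by grind) fun R'' _ hx => ?_
  refine cstit (i := i) (w := u i) (φ := (φ i).not) ?_ hx
    (identity (w := x) (φ := φ i) (by grind) (by grind))
  have := hu i (Finset.mem_univ i)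
  grind

theorem apc_axiom (hn : 0 < n) {w : ℕ} (i : Fin m) (φ : ℕ → Formula m)
    (h : ⟨w, .imp
          (Formula.conj ((List.range n).map fun k => .dia (Formula.conj
            ((List.range k).map (fun j => (φ j).not) ++ [.stit i (φ k)]))))
          (Formula.disj ((List.range n).map φ))⟩ ∈ Γ) :
    Derivable n m ⟨R, Γ⟩ := by
  refine imp h (conj_not (Multiset.mem_cons_self _ _) fun Γ₁ h₁ hb => ?_)
  have hd := h₁ (Multiset.mem_cons_of_mem (Multiset.mem_cons_self _ _))
  refine disj hd fun Γ₂ h₂ hw => ?_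
  refine boxes (Finset.range n) (w := w)
    (ψ := fun k => (Formula.conj ((List.range k).map (fun j => (φ j).not) ++ [.stit i (φ k)])).not)
    (fun k hk => h₂ (hb (.dia _) ?_)) fun Γ₃ u h₃ hu => ?_
  · exact List.mem_map.2 ⟨k, by simpa using hk, rfl⟩
  -- The `n + 1` labels are the `n` witnesses followed by `w`. An atom from `u k` to label `j`
  -- carries the negation of `φ k` there, where `φ k` already stands: from the `j`-th antecedent if
  -- `j < n`, from the consequent if `j = n`.
  refine apc hn i (fun k => if k < n then u k else w) fun k j hkj hj => ?_
  have hk : k < n := by omega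
  simp only [hk, if_true]
  refine conj_not (hu k (by simpa using hk)) fun Γ₄ h₄ hk => ?_
  have hc : ⟨u k, .cstit i (φ k).not⟩ ∈ Γ₄ := hk (.stit i (φ k)) (by simp)
  refine cstit (u := if j < n then u j else w) hc (Multiset.mem_cons_self _ _) ?_
  split_ifs with hjn
  · refine conj_not (Multiset.mem_cons_of_mem (h₄ (hu j (by simpa using hjn)))) fun Γ₅ h₅ hj => ?_
    refine identity (w := u j) (φ := φ k) ?_ (h₅ (Multiset.mem_cons_self _ _))
    simpa using hj (φ k).not (List.mem_append_left _ (List.mem_map.2 ⟨k, by simpa using hkj, rfl⟩))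
  · refine identity (w := w) (φ := φ k) (Multiset.mem_cons_of_mem ?_) (Multiset.mem_cons_self _ _)
    exact h₄ (h₃ (hw (φ k) (List.mem_map.2 ⟨k, by simp; omega, rfl⟩)))

end Derivable

open Derivable in
/-- Every theorem of the Hilbert system is derivable in the sequent calculus. -/
theorem HilbertTheorem.derivable {φ : Formula m} (h : HilbertTheorem n m φ) (w : ℕ) :
    Derivable n m ⟨0, {⟨w, φ⟩}⟩ := by
  induction h generalizing w with
  | prop1 φ ψ =>
    refine .imp (w := w) (Multiset.mem_singleton_self _) (.imp (w := w) (φ := ψ) (ψ := φ) ?_ ?_)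
    · grind
    · exact identity (w := w) (φ := φ) (by grind) (by grind)
  | prop2 φ ψ =>
    refine .imp (w := w) (Multiset.mem_singleton_self _) (.imp (w := w) (φ := φ) (ψ := ψ) ?_ ?_)
    · grind
    refine .and (w := w) (φ := ψ.not) (ψ := φ) (by simp [Formula.imp, Formula.not]) ?_ ?_
    · exact identity (w := w) (φ := ψ) (by grind) (by grind)
    · exact identity (w := w) (φ := φ) (by grind) (by grind)
  | prop3 φ ψ χ =>
    refine .imp (w := w) (Multiset.mem_singleton_self _)
      (.imp (w := w) (φ := .imp φ ψ) (ψ := .imp φ χ) (by grind)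
      (.imp (w := w) (φ := φ) (ψ := χ) (by grind) ?_))
    refine .and (w := w) (φ := φ) (ψ := .and ψ χ.not) (by simp [Formula.imp, Formula.not]) ?_ ?_
    · exact identity (w := w) (φ := φ) (by grind) (by grind)
    refine .and (w := w) (φ := φ) (ψ := ψ.not) (by simp [Formula.imp, Formula.not]) ?_ ?_
    · exact identity (w := w) (φ := φ) (by grind) (by grind)
    refine .and (w := w) (φ := ψ) (ψ := χ.not) (by simp) ?_ ?_
    · exact identity (w := w) (φ := ψ) (by grind) (by grind)
    · exact identity (w := w) (φ := χ) (by grind) (by grind)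
  | boxK φ ψ =>
    refine .imp (w := w) (Multiset.mem_singleton_self _)
      (.imp (w := w) (φ := .box φ) (ψ := .box ψ) (by grind)
      (.box (w := w) (φ := ψ) (by grind) fun v => ?_))
    refine .dia (w := w) (u := v) (φ := φ.not) (by simp [Formula.not]) ?_
    refine .dia (w := w) (u := v) (φ := .and φ ψ.not) (by simp [Formula.imp, Formula.not]) ?_
    refine .and (Multiset.mem_cons_self _ _) ?_ ?_
    · exact identity (w := v) (φ := φ) (by grind) (by grind)
    · exact identity (w := v) (φ := ψ) (by grind) (by grind)
  | boxT φ =>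
    refine .imp (w := w) (Multiset.mem_singleton_self _)
      (.dia (u := w) (φ := φ.not) (Multiset.mem_cons_self _ _) ?_)
    exact identity (w := w) (φ := φ) (by grind) (by grind)
  | box5 φ =>
    refine .imp (w := w) (Multiset.mem_singleton_self _)
      (.box (w := w) (φ := .dia φ) (by grind) fun v => ?_)
    refine .box (w := w) (φ := φ.not) (by simp [Formula.not]) fun u => ?_
    refine .dia (w := v) (u := u) (φ := φ) (by grind) ?_
    exact identity (w := u) (φ := φ) (by grind) (by grind)
  | boxDual φ =>
    refine .or (w := w) (Multiset.mem_singleton_self _) ?_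
    exact identity (w := w) (φ := .box φ) (by grind) (by grind [Formula.not])
  | stitK i φ ψ =>
    refine .imp (w := w) (Multiset.mem_singleton_self _)
      (.imp (w := w) (φ := .stit i φ) (ψ := .stit i ψ) (by grind)
      (.stit (w := w) (φ := ψ) (i := i) (by grind) fun v => ?_))
    refine .cstit (i := i) (w := w) (u := v) (φ := φ.not) (by simp [Formula.not]) (by grind) ?_
    refine .cstit (i := i) (w := w) (u := v) (φ := .and φ ψ.not)
      (by simp [Formula.imp, Formula.not]) (by grind) ?_
    refine .and (Multiset.mem_cons_self _ _) ?_ ?_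
    · exact identity (w := v) (φ := φ) (by grind) (by grind)
    · exact identity (w := v) (φ := ψ) (by grind) (by grind)
  | stitT i φ =>
    refine .imp (w := w) (Multiset.mem_singleton_self _) (.refl i w
      (.cstit (u := w) (φ := φ.not) (Multiset.mem_cons_self _ _) (by grind) ?_))
    exact identity (w := w) (φ := φ) (by grind) (by grind)
  | stit5 i φ =>
    refine .imp (w := w) (Multiset.mem_singleton_self _)
      (.stit (w := w) (i := i) (φ := .cstit i φ) (by grind) fun v => ?_)
    refine .stit (w := w) (i := i) (φ := φ.not) (by simp [Formula.not]) fun u => ?_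
    refine .eucl (i := i) (w := w) (u := v) (v := u) (by grind) (by grind) ?_
    refine .cstit (w := v) (u := u) (φ := φ) (i := i) (by grind) (by grind) ?_
    exact identity (w := u) (φ := φ) (by grind) (by grind)
  | stitDual i φ =>
    refine .or (w := w) (Multiset.mem_singleton_self _) ?_
    exact identity (w := w) (φ := .stit i φ) (by grind) (by grind [Formula.not])
  | ioa φ => exact ioa_axiom φ (Multiset.mem_singleton_self _)
  | bridge i φ =>
    refine .imp (w := w) (Multiset.mem_singleton_self _)
      (.stit (w := w) (i := i) (φ := φ) (by grind) fun v => ?_)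
    refine .dia (w := w) (u := v) (φ := φ.not) (by simp [Formula.not]) ?_
    exact identity (w := v) (φ := φ) (by grind) (by grind)
  | apc hn i φ => exact apc_axiom hn i φ (Multiset.mem_singleton_self _)
  | nec _ ih =>
    exact .box (w := w) (Multiset.mem_singleton_self _) fun v => (ih v).sub (by grind)
  | @mp φ ψ _ _ ih₁ ih₂ =>
    have d : Derivable n m ⟨0, ⟨w, .or φ.not ψ⟩ ::ₘ 0⟩ := ih₂ w
    exact cutAdmissible φ _ _ w ((ih₁ w).sub (by grind)) d.or_inv

/-! ### Semantics and soundness of the sequent calculus -/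

/-- Models of `Ldm_n^m` in which settledness is the universal modality. -/
structure Model (n m : ℕ) where
  World : Type
  rel : Fin m → World → World → Prop
  refl : ∀ i w, rel i w w
  eucl : ∀ i w u v, rel i w u → rel i w v → rel i u v
  ioa : ∀ u : Fin m → World, ∃ v, ∀ i, rel i (u i) v
  apc : 0 < n → ∀ (i : Fin m) (w : ℕ → World), ∃ k j, k < j ∧ j ≤ n ∧ rel i (w k) (w j)
  val : ℕ → World → Prop

namespace Model

/-- Truth of a formula at a world. -/
def Sat (M : Model n m) : Formula m → M.World → Prop
  | .pos p, w => M.val p w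
  | .neg p, w => ¬ M.val p w
  | .and φ ψ, w => M.Sat φ w ∧ M.Sat ψ w
  | .or φ ψ, w => M.Sat φ w ∨ M.Sat ψ w
  | .box φ, _ => ∀ v, M.Sat φ v
  | .dia φ, _ => ∃ v, M.Sat φ v
  | .stit i φ, w => ∀ v, M.rel i w v → M.Sat φ v
  | .cstit i φ, w => ∃ v, M.rel i w v ∧ M.Sat φ v

/-- Under the interpretation `ρ` of the labels, all atoms of the sequent hold and all its labelled
formulae fail. -/
def Refutes (M : Model n m) (ρ : ℕ → M.World) (s : Sequent m) : Prop :=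
  (∀ a ∈ s.rel, M.rel a.agent (ρ a.src) (ρ a.tgt)) ∧ ∀ f ∈ s.fml, ¬ M.Sat f.formula (ρ f.label)

variable {M : Model n m} {ρ : ℕ → M.World}

theorem refutes_append {e s : Sequent m} :
    M.Refutes ρ (e.append s) ↔ M.Refutes ρ e ∧ M.Refutes ρ s := by
  simp only [Refutes, mem_append_rel, mem_append_fml]
  grind

theorem Refutes.update {s : Sequent m} (h : M.Refutes ρ s) {v : ℕ} (hv : Fresh v s)
    (x : M.World) : M.Refutes (Function.update ρ v x) s := by
  refine ⟨fun a ha => ?_, fun f hf => ?_⟩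
  · rw [Function.update_of_ne (hv.1 a ha).1, Function.update_of_ne (hv.1 a ha).2]
    exact h.1 a ha
  · rw [Function.update_of_ne (hv.2 f hf)]
    exact h.2 f hf

/-- Countermodels pass upwards: each rule matches a truth clause or a frame condition, and an
eigenvariable can be reinterpreted by the world this supplies. -/
theorem Refutes.exists_premise {s : Sequent m} {E : Set (Sequent m)} (r : Step n m s E)
    (h : M.Refutes ρ s) : ∃ e ∈ E, ∃ ρ', M.Refutes ρ' (e.append s) := by
  simp only [refutes_append]
  cases r with
  | id h₁ h₂ => exact absurd (h.2 _ h₁) (h.2 _ h₂)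
  | and h₁ =>
    rcases not_and_or.1 (h.2 _ h₁) with h' | h'
    · exact ⟨_, .inl rfl, ρ, by simpa [Refutes] using h', h⟩
    · exact ⟨_, .inr rfl, ρ, by simpa [Refutes] using h', h⟩
  | or h₁ => exact ⟨_, rfl, ρ, by simpa [Refutes] using not_or.1 (h.2 _ h₁), h⟩
  | @stit i w v φ h₁ hv =>
    obtain ⟨x, hx, hφ⟩ : ∃ x, M.rel i (ρ w) x ∧ ¬ M.Sat φ x := by
      simpa [Sat] using h.2 _ h₁
    have hw : w ≠ v := hv.2 _ h₁
    exact ⟨_, rfl, Function.update ρ v x, by simpa [Refutes, hw] using ⟨hx, hφ⟩, h.update hv x⟩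
  | @box w v φ h₁ hv =>
    obtain ⟨x, hφ⟩ : ∃ x, ¬ M.Sat φ x := by simpa [Sat] using h.2 _ h₁
    exact ⟨_, rfl, Function.update ρ v x, by simpa [Refutes] using hφ, h.update hv x⟩
  | @dia w u φ h₁ =>
    exact ⟨_, rfl, ρ, by simpa [Refutes] using fun h' => h.2 _ h₁ ⟨_, h'⟩, h⟩
  | @cstit i w u φ h₁ h₂ =>
    exact ⟨_, rfl, ρ, by simpa [Refutes] using fun h' => h.2 _ h₁ ⟨_, h.1 _ h₂, h'⟩, h⟩
  | refl i w => exact ⟨_, rfl, ρ, by simpa [Refutes] using M.refl i (ρ w), h⟩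
  | @eucl i w u v h₁ h₂ =>
    exact ⟨_, rfl, ρ, by simpa [Refutes] using M.eucl i (ρ w) (ρ u) (ρ v) (h.1 _ h₁) (h.1 _ h₂), h⟩
  | ioa u v hv hu =>
    obtain ⟨x, hx⟩ := M.ioa fun i => ρ (u i)
    exact ⟨_, rfl, Function.update ρ v x, by simpa [Refutes, hu] using hx, h.update hv x⟩
  | apc hn i w =>
    obtain ⟨k, j, hk, hj, hr⟩ := M.apc hn i fun k => ρ (w k)
    exact ⟨_, ⟨k, j, hk, hj, rfl⟩, ρ, by simpa [Refutes] using hr, h⟩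

end Model

/-- Derivable sequents are valid. -/
theorem Deriv.not_refutes {h : ℕ} {s : Sequent m} (d : Deriv n m h s) (M : Model n m)
    (ρ : ℕ → M.World) : ¬ M.Refutes ρ s := by
  induction d generalizing ρ with
  | step r _ ih =>
    intro hs
    obtain ⟨e, he, ρ', h'⟩ := hs.exists_premise r
    exact ih e he ρ' h'

theorem Derivable.sat {φ : Formula m} {w : ℕ} (d : Derivable n m ⟨0, {⟨w, φ⟩}⟩) (M : Model n m)
    (x : M.World) : M.Sat φ x := by
  obtain ⟨h, d⟩ := derivable_iff.1 d
  by_contra hx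
  exact d.not_refutes M (fun _ => x) (by simpa [Model.Refutes] using hx)

/-! ### Hilbert deductions and maximal consistent sets -/

/-- Deducibility from a set of hypotheses in the Hilbert system, with modus ponens as only rule. -/
inductive Deducible (n : ℕ) {m : ℕ} (Δ : Set (Formula m)) : Formula m → Prop
  | hyp {φ : Formula m} (h : φ ∈ Δ) : Deducible n Δ φ
  | thm {φ : Formula m} (h : HilbertTheorem n m φ) : Deducible n Δ φ
  | mp {φ ψ : Formula m} (h : Deducible n Δ φ) (h' : Deducible n Δ (imp φ ψ)) : Deducible n Δ ψ

namespace Deducible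

variable {Δ : Set (Formula m)} {φ ψ χ : Formula m}

theorem mono {Δ' : Set (Formula m)} (h : Deducible n Δ φ) (hΔ : Δ ⊆ Δ') : Deducible n Δ' φ := by
  induction h with
  | hyp h => exact .hyp (hΔ h)
  | thm h => exact .thm h
  | mp _ _ h h' => exact .mp h h'

theorem weaken (h : Deducible n Δ φ) : Deducible n Δ (imp ψ φ) := .mp h (.thm (.prop1 φ ψ))

theorem imp_self : Deducible n Δ (imp φ φ) :=
  .mp (.thm (.prop1 φ φ)) (.mp (.thm (.prop1 φ (imp φ φ))) (.thm (.prop3 _ _ _)))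

/-- Sound because necessitation applies only inside theorems, never to hypotheses. -/
theorem deduction (h : Deducible n (insert φ Δ) ψ) : Deducible n Δ (imp φ ψ) := by
  induction h with
  | hyp h =>
    rcases h with rfl | h
    · exact imp_self
    · exact (Deducible.hyp h).weaken
  | thm h => exact (Deducible.thm h).weaken
  | mp _ _ h h' => exact .mp h (.mp h' (.thm (.prop3 _ _ _)))

theorem explosion (h : Deducible n Δ φ) (h' : Deducible n Δ φ.not) : Deducible n Δ ψ :=
  .mp h (.mp h'.weaken (.thm (.prop2 φ ψ)))

/-- The negation of `φ` yields a contradiction, hence also the negation of the theorem `φ → φ`; now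
contrapose. -/
theorem of_not_imp (h : Deducible n Δ (imp φ.not φ)) : Deducible n Δ φ := by
  have h' : Deducible n Δ (imp φ.not (imp φ φ).not) := deduction <|
    explosion (.mp (.hyp (Set.mem_insert _ _)) (h.mono (Set.subset_insert _ _)))
      (.hyp (Set.mem_insert _ _))
  exact .mp imp_self (.mp h' (.thm (.prop2 (imp φ φ) φ)))

theorem by_cases (h : Deducible n (insert φ Δ) ψ) (h' : Deducible n (insert φ.not Δ) ψ) :
    Deducible n Δ ψ := by
  have hc : Deducible n Δ (imp ψ.not φ.not) :=
    .mp (by simpa using h.deduction) (.thm (.prop2 ψ.not φ.not))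
  refine of_not_imp (deduction (.mp (φ := φ.not) (.mp (φ := ψ.not) (.hyp (Set.mem_insert _ _)) ?_) ?_))
  · exact hc.mono (Set.subset_insert _ _)
  · exact h'.deduction.mono (Set.subset_insert _ _)

theorem hilbertTheorem (h : Deducible n ∅ φ) : HilbertTheorem n m φ := by
  induction h with
  | hyp h => exact h.elim
  | thm h => exact h
  | mp _ _ h h' => exact .mp h h'

/-- Compactness, as needed for Zorn's lemma: modus ponens joins two members of the chain, and the
larger one serves for both. -/
theorem of_sUnion {c : Set (Set (Formula m))} (hc : IsChain (· ⊆ ·) c) (hne : c.Nonempty)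
    (h : Deducible n (⋃₀ c) φ) : ∃ Δ ∈ c, Deducible n Δ φ := by
  induction h with
  | hyp h =>
    obtain ⟨Δ, hΔ, h⟩ := h
    exact ⟨Δ, hΔ, .hyp h⟩
  | thm h => exact ⟨_, hne.some_mem, .thm h⟩
  | mp _ _ h h' =>
    obtain ⟨Δ, hΔ, h⟩ := h
    obtain ⟨Δ', hΔ', h'⟩ := h'
    rcases hc.total hΔ hΔ' with hs | hs
    · exact ⟨Δ', hΔ', .mp (h.mono hs) h'⟩
    · exact ⟨Δ, hΔ, .mp h (h'.mono hs)⟩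

end Deducible

/-- Maximal consistent sets of formulae. -/
structure MaximalConsistent (n : ℕ) (Δ : Set (Formula m)) : Prop where
  closed {φ : Formula m} : Deducible n Δ φ → φ ∈ Δ
  not_mem_iff {φ : Formula m} : φ.not ∈ Δ ↔ φ ∉ Δ

/-- Lindenbaum's lemma. -/
theorem exists_maximalConsistent {Δ : Set (Formula m)} {φ : Formula m} (h : ¬ Deducible n Δ φ) :
    ∃ Θ, Δ ⊆ Θ ∧ MaximalConsistent n Θ ∧ φ ∉ Θ := by
  obtain ⟨Θ, hΔ, hmax⟩ := zorn_subset_nonempty {Θ : Set (Formula m) | ¬ Deducible n Θ φ}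
    (fun c hc hch hne => ⟨⋃₀ c, fun hd => by
      obtain ⟨Θ, hΘ, hd⟩ := hd.of_sUnion hch hne
      exact hc hΘ hd, fun _ => Set.subset_sUnion_of_mem⟩) Δ h
  have hΘ : ¬ Deducible n Θ φ := hmax.prop
  have key : ∀ {ψ}, ψ ∉ Θ → Deducible n (insert ψ Θ) φ := by
    intro ψ hψ
    by_contra hd
    exact hψ (hmax.le_of_ge hd (Set.subset_insert _ _) (Set.mem_insert _ _))
  refine ⟨Θ, hΔ, ⟨fun {ψ} hd => ?_, fun {ψ} => ⟨fun h₁ h₂ => ?_, fun h₁ => ?_⟩⟩,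
    fun h => hΘ (.hyp h)⟩
  · by_contra hψ
    exact hΘ (.mp hd (key hψ).deduction)
  · exact hΘ (.explosion (.hyp h₂) (.hyp h₁))
  · by_contra h₂
    exact hΘ (.by_cases (key h₁) (key h₂))

namespace MaximalConsistent

variable {Δ : Set (Formula m)} (hΔ : MaximalConsistent n Δ) {φ ψ : Formula m}
include hΔ

theorem imp_mem_iff : imp φ ψ ∈ Δ ↔ (φ ∈ Δ → ψ ∈ Δ) := by
  refine ⟨fun h h' => hΔ.closed (.mp (.hyp h') (.hyp h)), fun h => hΔ.closed (.deduction ?_)⟩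
  by_cases hφ : φ ∈ Δ
  · exact .hyp (Set.mem_insert_of_mem _ (h hφ))
  · exact .explosion (.hyp (Set.mem_insert _ _))
      (.hyp (Set.mem_insert_of_mem _ (hΔ.not_mem_iff.2 hφ)))

theorem mem_of_hilbertTheorem (h : HilbertTheorem n m φ) : φ ∈ Δ := hΔ.closed (.thm h)

theorem mem_of_imp (h : HilbertTheorem n m (imp φ ψ)) (h' : φ ∈ Δ) : ψ ∈ Δ :=
  hΔ.imp_mem_iff.1 (hΔ.mem_of_hilbertTheorem h) h'

theorem or_mem_iff : or φ ψ ∈ Δ ↔ φ ∈ Δ ∨ ψ ∈ Δ := by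
  have h := hΔ.imp_mem_iff (φ := φ.not) (ψ := ψ)
  rw [hΔ.not_mem_iff] at h
  simp only [imp, Formula.not_not] at h
  tauto

theorem and_mem_iff : and φ ψ ∈ Δ ↔ φ ∈ Δ ∧ ψ ∈ Δ := by
  have h := hΔ.or_mem_iff (φ := φ.not) (ψ := ψ.not)
  have h' := hΔ.not_mem_iff (φ := .and φ ψ)
  simp only [Formula.not, hΔ.not_mem_iff] at h h'
  tauto

theorem top_mem : Formula.top ∈ Δ := by
  refine hΔ.or_mem_iff.2 ?_
  have := hΔ.not_mem_iff (φ := .pos 0)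
  simp only [Formula.not] at this
  tauto

theorem bot_notMem : Formula.bot ∉ Δ := by
  have := hΔ.not_mem_iff (φ := .pos 0)
  simp only [Formula.not] at this
  rw [Formula.bot, hΔ.and_mem_iff]
  tauto

theorem conj_mem_iff {l : List (Formula m)} : conj l ∈ Δ ↔ ∀ φ ∈ l, φ ∈ Δ := by
  induction l with
  | nil => simpa [conj] using hΔ.top_mem
  | cons φ l ih =>
    cases l with
    | nil => simp [conj]
    | cons ψ l => simp [conj, hΔ.and_mem_iff, ih]

theorem disj_mem_iff {l : List (Formula m)} : disj l ∈ Δ ↔ ∃ φ ∈ l, φ ∈ Δ := by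
  induction l with
  | nil => simpa [disj] using hΔ.bot_notMem
  | cons φ l ih =>
    cases l with
    | nil => simp [disj]
    | cons ψ l => simp [disj, hΔ.or_mem_iff, ih]

end MaximalConsistent

/-! ### Canonical relations of S5 operators, for `□` and `[i]` alike -/

/-- The operator `T` is an S5 modality of the Hilbert system. -/
structure IsS5 (n : ℕ) (T : Formula m → Formula m) : Prop where
  dist : ∀ φ ψ, HilbertTheorem n m (imp (T (imp φ ψ)) (imp (T φ) (T ψ)))
  reflexive : ∀ φ, HilbertTheorem n m (imp (T φ) φ)
  euclidean : ∀ φ, HilbertTheorem n m (imp (T φ).not (T (T φ).not))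
  nec : ∀ φ, HilbertTheorem n m φ → HilbertTheorem n m (T φ)

theorem isS5_box : IsS5 n (box : Formula m → Formula m) :=
  ⟨.boxK, .boxT, fun φ => .box5 φ.not, fun _ => .nec⟩

theorem isS5_stit (i : Fin m) : IsS5 n (stit i : Formula m → Formula m) :=
  ⟨.stitK i, .stitT i, fun φ => .stit5 i φ.not, fun _ h => .mp (.nec h) (.bridge i _)⟩

/-- The canonical accessibility relation of an operator. -/
def Access (T : Formula m → Formula m) (Δ Θ : Set (Formula m)) : Prop := ∀ φ, T φ ∈ Δ → φ ∈ Θ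

namespace IsS5

variable {T : Formula m → Formula m} (hT : IsS5 n T) {Δ Θ Ξ : Set (Formula m)}
include hT

theorem access_refl (hΔ : MaximalConsistent n Δ) : Access T Δ Δ :=
  fun φ => hΔ.mem_of_imp (hT.reflexive φ)

theorem access_eucl (hΔ : MaximalConsistent n Δ) (hΘ : MaximalConsistent n Θ) (h : Access T Δ Θ)
    (h' : Access T Δ Ξ) : Access T Θ Ξ := by
  intro φ hφ
  refine h' φ ?_
  by_contra hn
  exact hΘ.not_mem_iff.1 (h _ (hΔ.mem_of_imp (hT.euclidean φ) (hΔ.not_mem_iff.2 hn))) hφ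

theorem access_trans (hΔ : MaximalConsistent n Δ) (hΘ : MaximalConsistent n Θ)
    (h : Access T Δ Θ) (h' : Access T Θ Ξ) : Access T Δ Ξ :=
  hT.access_eucl hΘ hΔ (hT.access_eucl hΔ hΘ h (hT.access_refl hΔ)) h'

theorem mem_of_deducible (hΔ : MaximalConsistent n Δ) {φ : Formula m}
    (h : Deducible n {ψ | T ψ ∈ Δ} φ) : T φ ∈ Δ := by
  induction h with
  | hyp h => exact h
  | thm h => exact hΔ.mem_of_hilbertTheorem (hT.nec _ h)
  | mp _ _ h h' => exact hΔ.imp_mem_iff.1 (hΔ.mem_of_imp (hT.dist _ _) h') h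

/-- If `T φ` is missing, `φ` is not deducible from the formulae that `Δ` makes necessary, and
Lindenbaum's lemma gives an accessible set omitting it. -/
theorem mem_iff (hΔ : MaximalConsistent n Δ) {φ : Formula m} :
    T φ ∈ Δ ↔ ∀ Θ, MaximalConsistent n Θ → Access T Δ Θ → φ ∈ Θ := by
  refine ⟨fun h Θ _ hΘ => hΘ φ h, fun h => ?_⟩
  by_contra hn
  obtain ⟨Θ, hsub, hΘ, hφ⟩ := exists_maximalConsistent fun hd => hn (hT.mem_of_deducible hΔ hd)
  exact hφ (h Θ hΘ fun ψ hψ => hsub hψ)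

theorem and_mem (hΔ : MaximalConsistent n Δ) {φ ψ : Formula m} (hφ : T φ ∈ Δ) (hψ : T ψ ∈ Δ) :
    T (and φ ψ) ∈ Δ := by
  rw [hT.mem_iff hΔ] at *
  exact fun Θ hΘ h => hΘ.and_mem_iff.2 ⟨hφ Θ hΘ h, hψ Θ hΘ h⟩

theorem dual_mem_iff (hΔ : MaximalConsistent n Δ) {φ : Formula m} :
    (T φ.not).not ∈ Δ ↔ ∃ Θ, MaximalConsistent n Θ ∧ Access T Δ Θ ∧ φ ∈ Θ := by
  rw [hΔ.not_mem_iff, hT.mem_iff hΔ]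
  push Not
  refine exists_congr fun Θ => and_congr_right fun h => and_congr_right fun _ => ?_
  rw [h.not_mem_iff, Classical.not_not]

end IsS5

theorem MaximalConsistent.dia_mem_iff {Δ : Set (Formula m)} (hΔ : MaximalConsistent n Δ)
    {φ : Formula m} : dia φ ∈ Δ ↔ ∃ Θ, MaximalConsistent n Θ ∧ Access box Δ Θ ∧ φ ∈ Θ := by
  simpa [Formula.not] using isS5_box.dual_mem_iff hΔ (φ := φ)

theorem MaximalConsistent.cstit_mem_iff {Δ : Set (Formula m)} (hΔ : MaximalConsistent n Δ)
    {i : Fin m} {φ : Formula m} :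
    cstit i φ ∈ Δ ↔ ∃ Θ, MaximalConsistent n Θ ∧ Access (stit i) Δ Θ ∧ φ ∈ Θ := by
  simpa [Formula.not] using (isS5_stit i).dual_mem_iff hΔ (φ := φ)

/-! ### Frame conditions and truth lemma of the canonical model -/

section Canonical

variable {Δ : Set (Formula m)} (hΔ : MaximalConsistent n Δ)
include hΔ

theorem Access.of_stit {Θ : Set (Formula m)} {i : Fin m} (h : Access (stit i) Δ Θ) :
    Access box Δ Θ :=
  fun φ hφ => h φ (hΔ.mem_of_imp (.bridge i φ) hφ)

theorem canonical_ioa {U : Fin m → Set (Formula m)} (hU : ∀ i, MaximalConsistent n (U i))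
    (hUΔ : ∀ i, Access box Δ (U i)) :
    ∃ V, MaximalConsistent n V ∧ Access box Δ V ∧ ∀ i, Access (stit i) (U i) V := by
  -- A deduction uses finitely many hypotheses, so those of each agent condense into one formula `φ
  -- i`, to which the axiom applies. A contradiction deduced here would hold in the world that the
  -- axiom provides.
  have key : ∀ ψ, Deducible n ({ψ | box ψ ∈ Δ} ∪ {ψ | ∃ i, stit i ψ ∈ U i}) ψ →
      ∃ φ : Fin m → Formula m, (∀ i, stit i (φ i) ∈ U i) ∧
        ∀ Θ, MaximalConsistent n Θ → Access box Δ Θ → (∀ i, φ i ∈ Θ) → ψ ∈ Θ := by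
    have htop : ∀ i, stit i top ∈ U i := fun i =>
      (isS5_stit i).mem_iff (hU i) |>.2 fun Θ hΘ _ => hΘ.top_mem
    intro ψ h
    induction h with
    | @hyp ψ h =>
      rcases h with h | ⟨i, h⟩
      · exact ⟨fun _ => top, htop, fun Θ _ hΘ _ => hΘ ψ h⟩
      · refine ⟨Function.update (fun _ => top) i ψ, fun j => ?_, fun Θ _ _ hφ => ?_⟩
        · rcases eq_or_ne j i with rfl | hj
          · simpa using h
          · simpa [hj] using htop j
        · simpa using hφ i
    | thm h => exact ⟨fun _ => top, htop, fun Θ hΘ _ _ => hΘ.mem_of_hilbertTheorem h⟩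
    | mp _ _ h h' =>
      obtain ⟨φ, hφ, h⟩ := h
      obtain ⟨φ', hφ', h'⟩ := h'
      refine ⟨fun i => .and (φ i) (φ' i),
        fun i => (isS5_stit i).and_mem (hU i) (hφ i) (hφ' i), fun Θ hΘ hΔΘ hall => ?_⟩
      simp only [hΘ.and_mem_iff] at hall
      exact hΘ.imp_mem_iff.1 (h' Θ hΘ hΔΘ fun i => (hall i).2) (h Θ hΘ hΔΘ fun i => (hall i).1)
  obtain ⟨V, hsub, hV, -⟩ := exists_maximalConsistent (n := n) (φ := bot) fun hd => by
    obtain ⟨φ, hφ, h⟩ := key _ hd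
    have hdia := hΔ.mem_of_imp (.ioa φ) <| hΔ.conj_mem_iff.2 fun χ hχ => by
      obtain ⟨i, rfl⟩ := (List.mem_ofFn' _ _).1 hχ
      exact hΔ.dia_mem_iff.2 ⟨U i, hU i, hUΔ i, hφ i⟩
    obtain ⟨Θ, hΘ, hΔΘ, hc⟩ := hΔ.dia_mem_iff.1 hdia
    rw [hΘ.conj_mem_iff] at hc
    exact hΘ.bot_notMem (h Θ hΘ hΔΘ fun i =>
      (isS5_stit i).access_refl hΘ _ (hc _ ((List.mem_ofFn' _ _).2 ⟨i, rfl⟩)))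
  exact ⟨V, hV, fun φ hφ => hsub (.inl hφ), fun i φ hφ => hsub (.inr ⟨i, hφ⟩)⟩

/-- If no earlier world accesses a later one, conjoining the witnesses of failure gives for each `k`
one `φ k` with `[i]φ k` in `w k` and `φ k` in no later `w j`. Then `w k` witnesses the `k`-th
diamond of the choice axiom, so some `φ k` with `k < n` must lie in `w n`, a contradiction. -/
theorem canonical_apc (hn : 0 < n) (i : Fin m) {w : ℕ → Set (Formula m)}
    (hw : ∀ k, MaximalConsistent n (w k)) (hwΔ : ∀ k, Access box Δ (w k)) :
    ∃ k j, k < j ∧ j ≤ n ∧ Access (stit i) (w k) (w j) := by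
  by_contra! hcon
  have key : ∀ k N, N ≤ n → ∃ φ, stit i φ ∈ w k ∧ ∀ j, k < j → j ≤ N → φ ∉ w j := by
    intro k N
    induction N with
    | zero =>
      intro _
      refine ⟨top, (isS5_stit i).mem_iff (hw k) |>.2 fun Θ hΘ _ => hΘ.top_mem, ?_⟩
      intro j h h'
      omega
    | succ N ih =>
      intro hN
      obtain ⟨φ, hφ, h⟩ := ih (by omega)
      by_cases hk : k < N + 1
      · obtain ⟨ψ, hψ, h'⟩ : ∃ ψ, stit i ψ ∈ w k ∧ ψ ∉ w (N + 1) := by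
          simpa [Access] using hcon k (N + 1) hk hN
        refine ⟨.and φ ψ, (isS5_stit i).and_mem (hw k) hφ hψ, fun j hkj hj hmem => ?_⟩
        rw [(hw j).and_mem_iff] at hmem
        rcases hj.lt_or_eq with hj | rfl
        · exact h j hkj (by omega) hmem.1
        · exact h' hmem.2
      · exact ⟨φ, hφ, fun j h₁ h₂ => by omega⟩
  choose φ hφ hnot using fun k => key k n le_rfl
  -- The axiom is evaluated at `w n`, where every disjunct fails, so the diamonds must be moved
  -- there from `Δ`.
  have hbox : ∀ χ, dia χ ∈ Δ → dia χ ∈ w n := by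
    intro χ h
    exact hwΔ n _ (hΔ.mem_of_imp (.box5 χ) h)
  have hdisj := (hw n).mem_of_imp (.apc hn i φ) <| (hw n).conj_mem_iff.2 fun χ hχ => by
    obtain ⟨k, hk, rfl⟩ := List.mem_map.1 hχ
    refine hbox _ (hΔ.dia_mem_iff.2 ⟨w k, hw k, hwΔ k, (hw k).conj_mem_iff.2 fun ψ hψ => ?_⟩)
    rcases List.mem_append.1 hψ with hψ | hψ
    · obtain ⟨j, hj, rfl⟩ := List.mem_map.1 hψ
      exact (hw k).not_mem_iff.2 (hnot j k (List.mem_range.1 hj) (List.mem_range.1 hk).le)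
    · rw [List.mem_singleton.1 hψ]
      exact hφ k
  obtain ⟨_, hχ, hmem⟩ := (hw n).disj_mem_iff.1 hdisj
  obtain ⟨k, hk, rfl⟩ := List.mem_map.1 hχ
  exact hnot k n (List.mem_range.1 hk) le_rfl hmem

omit hΔ in
/-- The canonical model generated by a maximal consistent set. -/
def canonicalModel (hΔ : MaximalConsistent n Δ) : Model n m where
  World := {Θ : Set (Formula m) // MaximalConsistent n Θ ∧ Access box Δ Θ}
  rel i Θ Ξ := Access (stit i) Θ.1 Ξ.1
  refl i Θ := (isS5_stit i).access_refl Θ.2.1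
  eucl i Θ Ξ Ξ' h h' := (isS5_stit i).access_eucl Θ.2.1 Ξ.2.1 h h'
  ioa u := by
    obtain ⟨V, hV, hΔV, h⟩ := canonical_ioa hΔ (fun i => (u i).2.1) fun i => (u i).2.2
    exact ⟨⟨V, hV, hΔV⟩, h⟩
  apc hn i w := canonical_apc hΔ hn i (fun k => (w k).2.1) fun k => (w k).2.2
  val p Θ := .pos p ∈ Θ.1

theorem canonicalModel_sat_iff (φ : Formula m) (Θ : (canonicalModel hΔ).World) :
    (canonicalModel hΔ).Sat φ Θ ↔ φ ∈ Θ.1 := by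
  -- With `mem`, this says that the worlds are exactly the maximal consistent sets `□`-accessible
  -- from any one of them, as the universal reading of `□` requires.
  have acc : ∀ Θ Ξ : (canonicalModel hΔ).World, Access box Θ.1 Ξ.1 := fun Θ Ξ =>
    isS5_box.access_eucl hΔ Θ.2.1 Θ.2.2 Ξ.2.2
  have mem : ∀ (Θ : (canonicalModel hΔ).World) {Ξ}, Access box Θ.1 Ξ → Access box Δ Ξ :=
    fun Θ _ h => isS5_box.access_trans hΔ Θ.2.1 Θ.2.2 h
  induction φ generalizing Θ with
  | pos p => rfl
  | neg p => exact (Θ.2.1.not_mem_iff (φ := .pos p)).symm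
  | and φ ψ hφ hψ => exact (and_congr (hφ Θ) (hψ Θ)).trans Θ.2.1.and_mem_iff.symm
  | or φ ψ hφ hψ => exact (or_congr (hφ Θ) (hψ Θ)).trans Θ.2.1.or_mem_iff.symm
  | box φ ih =>
    rw [isS5_box.mem_iff Θ.2.1]
    exact ⟨fun h Ξ hΞ hr => (ih ⟨Ξ, hΞ, mem Θ hr⟩).1 (h _), fun h Ξ => (ih Ξ).2 (h _ Ξ.2.1 (acc Θ Ξ))⟩
  | dia φ ih =>
    rw [Θ.2.1.dia_mem_iff]
    exact ⟨fun ⟨Ξ, h⟩ => ⟨Ξ.1, Ξ.2.1, acc Θ Ξ, (ih Ξ).1 h⟩,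
      fun ⟨Ξ, hΞ, hr, h⟩ => ⟨⟨Ξ, hΞ, mem Θ hr⟩, (ih _).2 h⟩⟩
  | stit i φ ih =>
    rw [(isS5_stit i).mem_iff Θ.2.1]
    exact ⟨fun h Ξ hΞ hr => (ih ⟨Ξ, hΞ, mem Θ (hr.of_stit Θ.2.1)⟩).1 (h _ hr),
      fun h Ξ hr => (ih Ξ).2 (h _ Ξ.2.1 hr)⟩
  | cstit i φ ih =>
    rw [Θ.2.1.cstit_mem_iff]
    exact ⟨fun ⟨Ξ, hr, h⟩ => ⟨Ξ.1, Ξ.2.1, hr, (ih Ξ).1 h⟩,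
      fun ⟨Ξ, hΞ, hr, h⟩ => ⟨⟨Ξ, hΞ, mem Θ (hr.of_stit Θ.2.1)⟩, hr, (ih _).2 h⟩⟩

end Canonical

/-- Completeness of the Hilbert system. -/
theorem hilbertTheorem_of_sat {φ : Formula m} (h : ∀ (M : Model n m) (x : M.World), M.Sat φ x) :
    HilbertTheorem n m φ := by
  by_contra hφ
  obtain ⟨Δ, -, hΔ, hn⟩ := exists_maximalConsistent fun hd => hφ (Deducible.hilbertTheorem hd)
  exact hn ((canonicalModel_sat_iff hΔ φ ⟨Δ, hΔ, isS5_box.access_refl hΔ⟩).1 (h _ _))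

end STIT

open STIT in
theorem mainTheorem1 (n m : ℕ) :
    -- generalized identity sequents are derivable
    (∀ (R : Multiset (RelAtom m)) (Γ : Multiset (LabFormula m)) (w : ℕ) (φ : Formula m),
      Derivable n m ⟨R, ⟨w, φ⟩ ::ₘ ⟨w, φ.not⟩ ::ₘ Γ⟩) ∧
    -- substitution of labels is height-preserving admissible
    (∀ (h : ℕ) (s : Sequent m) (x y : ℕ),
      DerivableIn n m h s → DerivableIn n m h (s.subst y x)) ∧
    -- all inference rules are height-preserving invertible
    (∀ (h : ℕ) (prems : Set (Sequent m)) (c : Sequent m), Rule n m prems c →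
      DerivableIn n m h c → ∀ p ∈ prems, DerivableIn n m h p) ∧
    -- weakening is height-preserving admissible
    (∀ (h : ℕ) (R R' : Multiset (RelAtom m)) (Γ Γ' : Multiset (LabFormula m)),
      DerivableIn n m h ⟨R, Γ⟩ → DerivableIn n m h ⟨R + R', Γ' + Γ⟩) ∧
    -- contraction of relational atoms is height-preserving admissible
    (∀ (h : ℕ) (R R' : Multiset (RelAtom m)) (Γ : Multiset (LabFormula m)),
      DerivableIn n m h ⟨R + R' + R', Γ⟩ → DerivableIn n m h ⟨R + R', Γ⟩) ∧
    -- contraction of labelled formulae is height-preserving admissible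
    (∀ (h : ℕ) (R : Multiset (RelAtom m)) (Γ Γ' : Multiset (LabFormula m)),
      DerivableIn n m h ⟨R, Γ' + Γ' + Γ⟩ → DerivableIn n m h ⟨R, Γ' + Γ⟩) ∧
    -- cut is admissible
    (∀ (R : Multiset (RelAtom m)) (Γ : Multiset (LabFormula m)) (x : ℕ) (φ : Formula m),
      Derivable n m ⟨R, ⟨x, φ⟩ ::ₘ Γ⟩ → Derivable n m ⟨R, ⟨x, φ.not⟩ ::ₘ Γ⟩ →
        Derivable n m ⟨R, Γ⟩) ∧
    -- soundness and completeness relative to the Hilbert system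
    (∀ (φ : Formula m) (w : ℕ), Derivable n m ⟨0, {⟨w, φ⟩}⟩ ↔ HilbertTheorem n m φ) := by
  refine ⟨fun R Γ w φ => ?_, fun h s x y d => d.mapLabels _,
    fun h prems c r d => r.premise_derivableIn d, fun h R R' Γ Γ' d => d.sub ?_,
    fun h R R' Γ d => d.sub ?_, fun h R Γ Γ' d => d.sub ?_, fun R Γ x φ => cutAdmissible φ R Γ x,
    fun φ w => ⟨fun d => hilbertTheorem_of_sat d.sat, fun h => h.derivable w⟩⟩
  · exact .identity (Multiset.mem_cons_self _ _)
      (Multiset.mem_cons_of_mem (Multiset.mem_cons_self _ _))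
  all_goals grind
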